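/- All digraphs are finite, without loops and without multiple arcs, but two opposite arcs $uv$ and $vu$ are allowed. Cycles are directed cycles, and the girth of a digraph is the length of a shortest cycle ($\infty$ if there is none). An acyclic homomorphism from a digraph $D$ to a digraph $C$ is a map $\rho\colon V(D)\to V(C)$ such that for every arc $uv$ of $D$ either $\rho(u)=\rho(v)$ or $\rho(u)\rho(v)$ is an arc of $C$, and such that for every vertex $x$ of $C$ the subdigraph of $D$ induced by $\rho^{-1}(x)$ has no cycle. We write $D\to C$ if such a map exists. A digraph $C$ is $D$-pointed if there are no two acyclic homomorphisms $\rho,\varphi\colon D\to C$ such that $\rho(v)\ne\varphi(v)$ holds for exactly one vertex $v$ of $D$. **Theorem 1.** For every digraph $D$ and all positive integers $k$ and $\ell$ there exist a digraph $D^*$ and a surjective acyclic homomorphism $\psi\colon D^*\to D$ with the following properties: 1. the girth of $D^*$ is at least $\ell$; 2. for every digraph $C$ with at most $k$ vertices, $D^*\to C$ if and only if $D\to C$; 3. for every $D$-pointed digraph $C$ with at most $k$ vertices and every acyclic homomorphism $\varphi\colon D^*\to C$ there exists a unique acyclic homomorphism $f\colon D\to C$ such that $\varphi=f\circ\psi$.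 -/

import Mathlib

universe u v

namespace Digraph

/-- A digraph is loopless if no vertex is joined to itself. Multiple arcs are excluded by `Digraph`
itself, while two opposite arcs `(a, b)` and `(b, a)` are allowed. -/
def Loopless {V : Type u} (D : Digraph V) : Prop :=
  ∀ a : V, ¬ D.Adj a a

/-- `D.IsDirCycle m c`: the vertices `c 0, c 1, …, c (m - 1)` are pairwise distinct, `m` is positive,
and `c 0 → c 1 → ⋯ → c (m - 1) → c 0` are arcs of `D`, i.e. `c` is a directed cycle of length `m`. -/
structure IsDirCycle {V : Type u} (D : Digraph V) (m : ℕ) (c : Fin m → V) : Prop where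
  pos : 0 < m
  injective : Function.Injective c
  adj : ∀ i : Fin m, D.Adj (c i) (c (finRotate m i))

/-- A digraph is acyclic if it has no directed cycle. -/
def IsAcyclic {V : Type u} (D : Digraph V) : Prop :=
  ∀ (m : ℕ) (c : Fin m → V), ¬ D.IsDirCycle m c

/-- The girth: the length of a shortest directed cycle, and `⊤` if there is no directed cycle. -/
noncomputable def girth {V : Type u} (D : Digraph V) : ℕ∞ :=
  ⨅ (m : ℕ) (_ : ∃ c : Fin m → V, D.IsDirCycle m c), (m : ℕ∞)

/-- The subdigraph of `D` induced by a set of vertices. -/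
def induce {V : Type u} (D : Digraph V) (s : Set V) : Digraph s where
  Adj a b := D.Adj a b

/-- Acyclic homomorphisms `ρ` of `D` to `C`. -/
structure IsAcyclicHom {V : Type u} {U : Type v} (D : Digraph V) (C : Digraph U) (ρ : V → U) :
    Prop where
  map_adj : ∀ a b : V, D.Adj a b → ρ a = ρ b ∨ C.Adj (ρ a) (ρ b)
  acyclic_fiber : ∀ x : U, (D.induce (ρ ⁻¹' {x})).IsAcyclic

/-- `D → C`: there is an acyclic homomorphism of `D` to `C`. -/
def HomomorphicTo {V : Type u} {U : Type v} (D : Digraph V) (C : Digraph U) : Prop :=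
  ∃ ρ : V → U, D.IsAcyclicHom C ρ

/-- `C.IsPointed D`: the digraph `C` is `D`-pointed, i.e. no two acyclic homomorphisms of `D` to `C`
differ at exactly one vertex of `D`. -/
def IsPointed {V : Type u} {U : Type v} (C : Digraph U) (D : Digraph V) : Prop :=
  ¬ ∃ ρ φ : V → U, D.IsAcyclicHom C ρ ∧ D.IsAcyclicHom C φ ∧ ∃! a : V, ρ a ≠ φ a

end Digraph

/-!
The digraph `D*` is a union of *stretched copies* of `D`. Over each vertex of `D` there are
`k * l` levels with `n` vertices each. A copy has a root `x`, which represents the vertex of `D`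
below it; each other vertex `b` of `D` is replaced by a directed path with `l` vertices over `b`,
on increasing levels. So a closed walk inside a copy has at least `l` steps
(`le_of_reachIn_copyAdj`), and no arc of `D*` leads to a lower or equal level of the same fibre,
which makes the projection to `D` an acyclic homomorphism (`isAcyclicHom_fst`). Conversely, closed
walks of `D` lift to each copy. Hence an acyclic homomorphism of `D*` that takes only the value
`f b` on the points over `b` of some copy, for each `b`, yields an acyclic homomorphism `f` of `D`
(`isAcyclicHom_of_copy`).

`exists_spread_family` provides copies whose union has no short closed walks, and which are so
well spread that each tuple of large sets contains a copy, and that each small nonempty set `X`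
contains the root of a copy that avoids `X` otherwise. Let `φ` be an acyclic homomorphism of `D*`
to a digraph `C` with at most `k` vertices. By pigeonhole, over each vertex `b` some colour `f b`
is frequent in `l` levels, and by the first property `f` is an acyclic homomorphism of `D`. The
root of a copy may lie in any level, so if a colour `c` is frequent in a single level over `a`,
changing `f a` to `c` gives another acyclic homomorphism; if `C` is `D`-pointed, then `c = f a`.
The set `X` of vertices where `φ` differs from `f` is therefore small. If it were nonempty, the
second property would give `x ∈ X` with a copy rooted at `x` that takes the values of `f` outside
its root, and changing `f` to `φ x` below `x` would again contradict that `C` is `D`-pointed. So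
`φ` is `f` composed with the projection.

The well spread family comes from a greedy argument that derandomizes a random choice of the
copies (`exists_greedy_choice`). Each new copy must have points that are far apart in the union of
the previous ones, so that it closes no short walk (`not_reachIn_union`), and must not use a
vertex that many copies use already, which keeps the degrees and thus the neighbourhoods bounded.
These conditions exclude only a small proportion of the choices, so that union bounds over all
large and all small sets of vertices remain valid.
-/

/-! ### Walks and acyclicity -/

namespace Digraph

/-- `ReachIn R m a b`: there is a walk with exactly `m` steps from `a` to `b` along the
relation `R`. Vertices may be repeated. -/
def ReachIn {α : Type*} (R : α → α → Prop) : ℕ → α → α → Prop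
  | 0, a, b => a = b
  | m + 1, a, b => ∃ c, R a c ∧ ReachIn R m c b

section ReachIn

variable {α : Type*} {R Q : α → α → Prop}

theorem ReachIn.mono (h : ∀ a b, R a b → Q a b) {m : ℕ} {a b : α} (hw : ReachIn R m a b) :
    ReachIn Q m a b := by
  induction m generalizing a with
  | zero => exact hw
  | succ m ih =>
    obtain ⟨c, hac, hcb⟩ := hw
    exact ⟨c, h _ _ hac, ih hcb⟩

theorem ReachIn.snoc {m : ℕ} {a b c : α} (hw : ReachIn R m a b) (hbc : R b c) :
    ReachIn R (m + 1) a c := by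
  induction m generalizing a with
  | zero =>
    obtain rfl : a = b := hw
    exact ⟨c, hbc, rfl⟩
  | succ m ih =>
    obtain ⟨d, had, hdb⟩ := hw
    exact ⟨d, had, ih hdb⟩

theorem ReachIn.symm (hR : ∀ a b, R a b → R b a) {m : ℕ} {a b : α} (hw : ReachIn R m a b) :
    ReachIn R m b a := by
  induction m generalizing a with
  | zero => exact Eq.symm hw
  | succ m ih =>
    obtain ⟨c, hac, hcb⟩ := hw
    exact (ih hcb).snoc (hR _ _ hac)

theorem reachIn_of_forall {c : ℕ → α} {m : ℕ} (h : ∀ i < m, R (c i) (c (i + 1))) :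
    ReachIn R m (c 0) (c m) := by
  induction m with
  | zero => rfl
  | succ m ih => exact (ih fun i hi => h i (by omega)).snoc (h m (by omega))

theorem ReachIn.exists_fun {m : ℕ} {a b : α} (hw : ReachIn R m a b) :
    ∃ c : ℕ → α, c 0 = a ∧ c m = b ∧ ∀ i < m, R (c i) (c (i + 1)) := by
  induction m generalizing a with
  | zero => exact ⟨fun _ => a, rfl, hw, fun i hi => absurd hi (Nat.not_lt_zero i)⟩
  | succ m ih =>
    obtain ⟨d, had, hdb⟩ := hw
    obtain ⟨c, h0, hm, hc⟩ := ih hdb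
    refine ⟨fun i => i.casesOn a c, rfl, hm, ?_⟩
    rintro (_ | i) hi
    · simpa [h0] using had
    · exact hc i (by omega)

theorem exists_reachIn_of_transGen {a b : α} (h : Relation.TransGen R a b) :
    ∃ m, 0 < m ∧ ReachIn R m a b := by
  induction h with
  | single h => exact ⟨1, one_pos, _, h, rfl⟩
  | tail _ h ih =>
    obtain ⟨m, _, hm⟩ := ih
    exact ⟨m + 1, m.succ_pos, hm.snoc h⟩

theorem ReachIn.transGen {m : ℕ} {a b : α} (hm : 0 < m) (hw : ReachIn R m a b) :
    Relation.TransGen R a b := by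
  induction m generalizing a with
  | zero => exact absurd hm (lt_irrefl 0)
  | succ m ih =>
    obtain ⟨c, hac, hcb⟩ := hw
    rcases m.eq_zero_or_pos with rfl | hpos
    · obtain rfl : c = b := hcb
      exact .single hac
    · exact .head hac (ih hpos hcb)

end ReachIn

section Acyclic

variable {V : Type u} {D : Digraph V}

theorem IsDirCycle.reachIn {m : ℕ} {c : Fin m → V} (h : D.IsDirCycle m c) :
    ReachIn D.Adj m (c ⟨0, h.pos⟩) (c ⟨0, h.pos⟩) := by
  obtain ⟨m, rfl⟩ : ∃ k, m = k + 1 := ⟨m - 1, by have := h.pos; omega⟩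
  have key := reachIn_of_forall (R := D.Adj) (m := m + 1)
    (c := fun i => if hi : i < m + 1 then c ⟨i, hi⟩ else c ⟨0, h.pos⟩) ?_
  · simpa using key
  · intro i hi
    have hadj := h.adj ⟨i, hi⟩
    rcases Nat.lt_or_ge i m with him | him
    · rw [finRotate_of_lt him] at hadj
      simpa [hi, him] using hadj
    · obtain rfl : i = m := by omega
      rw [finRotate_last'] at hadj
      simpa using hadj

/-- A shortest closed walk is a directed cycle, so an acyclic digraph has no closed walk. -/
theorem IsAcyclic.not_transGen (h : D.IsAcyclic) (a : V) : ¬ Relation.TransGen D.Adj a a := by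
  classical
  intro ha
  have hex : ∃ m, 0 < m ∧ ∃ b, ReachIn D.Adj m b b := by
    obtain ⟨m, hm, hw⟩ := exists_reachIn_of_transGen ha
    exact ⟨m, hm, a, hw⟩
  obtain ⟨hm, b, hw⟩ := Nat.find_spec hex
  have hmin := fun i (hi : i < Nat.find hex) => Nat.find_min hex hi
  generalize Nat.find hex = m at hm hw hmin
  obtain ⟨c, h0, hcm, hc⟩ := hw.exists_fun
  have hinj : ∀ i j, i < j → j < m → c i ≠ c j := by
    intro i j hij hj hcij
    refine hmin (j - i) (by omega) ⟨by omega, c i, ?_⟩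
    have := reachIn_of_forall (R := D.Adj) (c := fun t => c (i + t)) (m := j - i)
      fun t ht => hc (i + t) (by omega)
    simpa [Nat.add_sub_cancel' hij.le, ← hcij] using this
  refine h m (fun i => c i) ⟨hm, ?_, ?_⟩
  · intro i j hij
    rcases lt_trichotomy i j with hlt | heq | hlt
    · exact absurd hij (hinj _ _ hlt j.2)
    · exact heq
    · exact absurd hij.symm (hinj _ _ hlt i.2)
  · obtain ⟨m, rfl⟩ : ∃ k, m = k + 1 := ⟨m - 1, by omega⟩
    rintro ⟨i, hi⟩
    rcases Nat.lt_or_ge i m with him | him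
    · rw [finRotate_of_lt him]
      exact hc i hi
    · obtain rfl : i = m := by omega
      rw [finRotate_last']
      simpa [h0, hcm] using hc i hi

theorem isAcyclic_of_not_transGen (h : ∀ a, ¬ Relation.TransGen D.Adj a a) : D.IsAcyclic :=
  fun _ _ hc => h _ (hc.reachIn.transGen hc.pos)

theorem le_girth_of_not_reachIn {l : ℕ} (h : ∀ m, 0 < m → m < l → ∀ a, ¬ ReachIn D.Adj m a a) :
    (l : ℕ∞) ≤ D.girth := by
  refine le_iInf fun m => le_iInf fun ⟨c, hc⟩ => ?_
  by_contra hlt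
  exact h m hc.pos (by exact_mod_cast not_le.mp hlt) _ hc.reachIn

theorem transGen_induce {s : Set V} {a b : V}
    (h : Relation.TransGen (fun x y => D.Adj x y ∧ x ∈ s ∧ y ∈ s) a b) :
    ∃ (ha : a ∈ s) (hb : b ∈ s), Relation.TransGen (D.induce s).Adj ⟨a, ha⟩ ⟨b, hb⟩ := by
  induction h with
  | single h => exact ⟨h.2.1, h.2.2, .single h.1⟩
  | tail _ h ih =>
    obtain ⟨ha, hb, ih⟩ := ih
    exact ⟨ha, h.2.2, ih.tail h.1⟩

/-- A closed walk with all its vertices in one fibre contradicts an acyclic homomorphism. -/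
theorem IsAcyclicHom.not_transGen {U : Type v} {C : Digraph U} {ρ : V → U}
    (h : D.IsAcyclicHom C ρ) (x : U) (a : V) :
    ¬ Relation.TransGen (fun y z => D.Adj y z ∧ ρ y = x ∧ ρ z = x) a a := by
  intro hw
  obtain ⟨ha, _, hw⟩ := transGen_induce (s := ρ ⁻¹' {x}) hw
  exact (h.acyclic_fiber x).not_transGen _ hw

theorem isAcyclicHom_of_not_transGen {U : Type v} {C : Digraph U} {ρ : V → U}
    (hadj : ∀ a b : V, D.Adj a b → ρ a = ρ b ∨ C.Adj (ρ a) (ρ b))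
    (hfib : ∀ x a, ¬ Relation.TransGen (fun y z => D.Adj y z ∧ ρ y = x ∧ ρ z = x) a a) :
    D.IsAcyclicHom C ρ := by
  refine ⟨hadj, fun x => isAcyclic_of_not_transGen fun a ha => hfib x a.1 ?_⟩
  exact ha.lift Subtype.val fun y z hyz => ⟨hyz, y.2, z.2⟩

/-- Acyclic homomorphisms compose. A closed walk in a fibre of the composite projects to a closed
walk that may stand still; it cannot stand still all the time, as it would then lie in one fibre
of `ρ`. -/
theorem IsAcyclicHom.comp {V' : Type*} {U : Type v} {D' : Digraph V'} {C : Digraph U} {ρ : V → V'}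
    {f : V' → U} (hf : D'.IsAcyclicHom C f) (hρ : D.IsAcyclicHom D' ρ) :
    D.IsAcyclicHom C (f ∘ ρ) := by
  refine isAcyclicHom_of_not_transGen (fun a b hab => ?_) fun x a ha => ?_
  · rcases hρ.map_adj a b hab with h | h
    · exact .inl (congrArg f h)
    · exact hf.map_adj _ _ h
  · have key : ∀ b, Relation.TransGen
        (fun y z => D.Adj y z ∧ (f ∘ ρ) y = x ∧ (f ∘ ρ) z = x) a b →
        Relation.TransGen (fun y z => D'.Adj y z ∧ f y = x ∧ f z = x) (ρ a) (ρ b) ∨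
        (ρ b = ρ a ∧ Relation.TransGen (fun y z => D.Adj y z ∧ ρ y = ρ a ∧ ρ z = ρ a) a b) := by
      intro b hb
      induction hb with
      | single h =>
        rcases hρ.map_adj _ _ h.1 with h' | h'
        · exact .inr ⟨h'.symm, .single ⟨h.1, rfl, h'.symm⟩⟩
        · exact .inl (.single ⟨h', h.2⟩)
      | tail _ h ih =>
        rcases hρ.map_adj _ _ h.1 with h' | h' <;> rcases ih with ih | ⟨ih, ihw⟩
        · exact .inl (h' ▸ ih)
        · exact .inr ⟨h'.symm.trans ih, ihw.tail ⟨h.1, ih, h'.symm.trans ih⟩⟩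
        · exact .inl (ih.tail ⟨h', h.2⟩)
        · exact .inl (.single ⟨ih ▸ h', by simpa [ih] using h.2.1, h.2.2⟩)
    rcases key a ha with h | ⟨_, h⟩
    · exact hf.not_transGen x _ h
    · exact hρ.not_transGen _ _ h

end Acyclic

end Digraph

/-! ### Greedy choices -/

open Finset in
/-- Greedy choice by the method of conditional expectations. Values `ω h` are chosen one after the
other. At each step at least `c` values keep the invariant `P`; an event `i ∈ E` survives the step
`h` if `ω h ∈ Bad i h`, and a proportion of at most `q i h` of the allowed values lets it survive.
If the events have total weight `∑ i ∈ E, ∏ h, q i h < 1`, then the choices can be made such that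
no event survives: some allowed value is no worse than the average, so the total weight of the
surviving events never increases. -/
theorem exists_greedy_choice {H Ω I : Type*} [Fintype H] [DecidableEq H] [Fintype Ω]
    (P : Finset H → (H → Ω) → Prop) (c : ℝ) (q : I → H → ℝ) (hq : ∀ i h, 0 ≤ q i h)
    (Bad : I → H → Finset Ω) (E : Finset I)
    (hbad : ∀ i ∈ E, ∀ h, 1 ≤ q i h ∨ (#(Bad i h) : ℝ) ≤ q i h * c)
    (ω₀ : H → Ω) (h0 : P ∅ ω₀) (hc : 0 < c)
    (hstep : ∀ S ω h, P S ω → h ∉ S → ∃ A : Finset Ω, c ≤ (#A : ℝ) ∧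
      ∀ o ∈ A, ∃ ω', P (insert h S) ω' ∧ ω' h = o ∧ ∀ h' ∈ S, ω' h' = ω h')
    (hsum : ∑ i ∈ E, ∏ h, q i h < 1) :
    ∃ ω : H → Ω, P univ ω ∧ ∀ i ∈ E, ∃ h, ω h ∉ Bad i h := by
  classical
  suffices key : ∀ m (S : Finset H) ω, #Sᶜ = m → P S ω →
      ∑ i ∈ E with ∀ h ∈ S, ω h ∈ Bad i h, ∏ h ∈ Sᶜ, q i h < 1 →
      ∃ ω : H → Ω, P univ ω ∧ ∀ i ∈ E, ∃ h, ω h ∉ Bad i h from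
    key _ ∅ ω₀ rfl h0 (by simpa using hsum)
  intro m
  induction m with
  | zero =>
    intro S ω hS hP hlt
    obtain rfl : S = univ := by simpa using hS
    refine ⟨ω, hP, fun i hi => ?_⟩
    by_contra! hcon
    have hmem : i ∈ E.filter fun i => ∀ h ∈ univ, ω h ∈ Bad i h := by simp [hi, hcon]
    have : (1 : ℝ) ≤ #(E.filter fun i => ∀ h ∈ univ, ω h ∈ Bad i h) := by
      exact_mod_cast card_pos.mpr ⟨i, hmem⟩
    simp only [compl_univ, prod_empty, sum_const, nsmul_eq_mul, mul_one] at hlt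
    linarith
  | succ m ih =>
    intro S ω hS hP hlt
    obtain ⟨h, hh⟩ : (Sᶜ).Nonempty := card_pos.mp (by omega)
    have hhS : h ∉ S := by simpa using hh
    obtain ⟨A, hA, hAP⟩ := hstep S ω h hP hhS
    set L := E.filter fun i => ∀ h ∈ S, ω h ∈ Bad i h with hL
    set w : I → ℝ := fun i => ∏ h' ∈ (insert h S)ᶜ, q i h' with hw
    have hw0 : ∀ i, 0 ≤ w i := fun i => prod_nonneg fun _ _ => hq _ _
    have hprod : ∀ i, ∏ h' ∈ Sᶜ, q i h' = q i h * w i := by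
      intro i
      rw [hw, compl_insert, mul_prod_erase _ _ hh]
    have hcount : ∀ i ∈ E, (#(A.filter fun o => o ∈ Bad i h) : ℝ) ≤ q i h * #A := by
      intro i hi
      rcases hbad i hi h with h1 | h1
      · calc (#(A.filter fun o => o ∈ Bad i h) : ℝ) ≤ #A := by
              exact_mod_cast card_le_card (filter_subset _ _)
          _ ≤ q i h * #A := le_mul_of_one_le_left (by positivity) h1
      · calc (#(A.filter fun o => o ∈ Bad i h) : ℝ) ≤ #(Bad i h) := by
              exact_mod_cast card_le_card fun o ho => (mem_filter.mp ho).2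
          _ ≤ q i h * c := h1
          _ ≤ q i h * #A := mul_le_mul_of_nonneg_left hA (hq _ _)
    have hApos : (0 : ℝ) < #A := hc.trans_le hA
    have havg : ∑ o ∈ A, ∑ i ∈ L with o ∈ Bad i h, w i < ∑ o ∈ A, (1 : ℝ) := by
      calc ∑ o ∈ A, ∑ i ∈ L with o ∈ Bad i h, w i
          = ∑ i ∈ L, (#(A.filter fun o => o ∈ Bad i h) : ℝ) * w i := by
            simp only [sum_filter]
            rw [sum_comm]
            refine sum_congr rfl fun i _ => ?_
            rw [← sum_filter, sum_const, nsmul_eq_mul]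
        _ ≤ ∑ i ∈ L, q i h * #A * w i := sum_le_sum fun i hi =>
            mul_le_mul_of_nonneg_right (hcount i (mem_filter.mp hi).1) (hw0 i)
        _ = (∑ i ∈ L, ∏ h' ∈ Sᶜ, q i h') * #A := by
            rw [sum_mul]
            refine sum_congr rfl fun i _ => ?_
            rw [hprod]
            ring
        _ < 1 * #A := mul_lt_mul_of_pos_right hlt hApos
        _ = ∑ o ∈ A, (1 : ℝ) := by simp
    obtain ⟨o, ho, hlt'⟩ := exists_lt_of_sum_lt havg
    obtain ⟨ω', hP', hω'h, hω'S⟩ := hAP o ho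
    refine ih (insert h S) ω' ?_ hP' ?_
    · rw [compl_insert, card_erase_of_mem hh, hS]
      rfl
    · suffices heq : (E.filter fun i => ∀ h' ∈ insert h S, ω' h' ∈ Bad i h') =
          L.filter fun i => o ∈ Bad i h by rwa [heq]
      ext i
      simp only [hL, mem_filter, mem_insert, forall_eq_or_imp, hω'h]
      constructor
      · rintro ⟨h1, h2, h3⟩
        exact ⟨⟨h1, fun h' hh' => hω'S h' hh' ▸ h3 h' hh'⟩, h2⟩
      · rintro ⟨⟨h1, h3⟩, h2⟩
        exact ⟨h1, h2, fun h' hh' => (hω'S h' hh').symm ▸ h3 h' hh'⟩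

open Finset in
/-- If the set `N o` of at most `β` values does not depend on the coordinate `σ` of `o`, then at
most a fraction `β / n` of all `o` have their coordinate `σ` in `N o`. -/
theorem card_coord_mem_le {ι : Type*} [Fintype ι] [DecidableEq ι] {n : ℕ} (σ : ι)
    (N : (ι → Fin n) → Finset (Fin n)) (hN : ∀ o y, N (Function.update o σ y) = N o)
    (β : ℝ) (hβ : ∀ o, (#(N o) : ℝ) ≤ β) :
    (#{o : ι → Fin n | o σ ∈ N o} : ℝ) * n ≤ β * (n : ℝ) ^ Fintype.card ι := by
  have hdc : #{o : ι → Fin n | o σ ∈ N o} * n = ∑ o : ι → Fin n, #(N o) := by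
    have h1 : ∀ o : ι → Fin n, #(N o) = ∑ y : Fin n, if y ∈ N o then 1 else 0 := by simp
    simp only [h1, card_filter]
    have e := Equiv.sum_comp (Equiv.funSplitAt σ (Fin n)).symm
      (fun o : ι → Fin n => if o σ ∈ N o then 1 else 0)
    have e' := Equiv.sum_comp (Equiv.funSplitAt σ (Fin n)).symm
      (fun o : ι → Fin n => ∑ y : Fin n, if y ∈ N o then 1 else 0)
    rw [← e, ← e', Fintype.sum_prod_type, Fintype.sum_prod_type]
    have hup : ∀ y z r, N ((Equiv.funSplitAt σ (Fin n)).symm (y, r))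
        = N ((Equiv.funSplitAt σ (Fin n)).symm (z, r)) := by
      intro y z r
      rw [← hN ((Equiv.funSplitAt σ (Fin n)).symm (z, r)) y]
      congr 1
      ext j
      by_cases hj : j = σ
      · subst hj; simp [Equiv.funSplitAt, Equiv.piSplitAt]
      · simp [Equiv.funSplitAt, Equiv.piSplitAt, hj]
    have hσ : ∀ y r, (Equiv.funSplitAt σ (Fin n)).symm (y, r) σ = y := by
      intro y r
      simp [Equiv.funSplitAt, Equiv.piSplitAt]
    simp only [hσ]
    rcases Nat.eq_zero_or_pos n with rfl | hn
    · simp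
    · rw [sum_comm, sum_comm (s := univ (α := Fin n)), sum_mul]
      refine sum_congr rfl fun r _ => ?_
      have : ∀ x y : Fin n, (if y ∈ N ((Equiv.funSplitAt σ (Fin n)).symm (x, r)) then 1 else 0)
          = if y ∈ N ((Equiv.funSplitAt σ (Fin n)).symm (y, r)) then 1 else 0 := by
        intro x y
        rw [hup x y r]
      rw [sum_congr rfl fun x _ => sum_congr rfl fun y _ => this x y, sum_const, card_univ,
        Fintype.card_fin, smul_eq_mul, mul_comm]
  calc (#{o : ι → Fin n | o σ ∈ N o} : ℝ) * n = ∑ o : ι → Fin n, (#(N o) : ℝ) := by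
        exact_mod_cast hdc
    _ ≤ ∑ _o : ι → Fin n, β := sum_le_sum fun o _ => hβ o
    _ = β * (n : ℝ) ^ Fintype.card ι := by simp [mul_comm]

/-! ### Stretched copies of a digraph -/

namespace Digraph

/-- The vertices of the digraph to be constructed: over each vertex of `V` there are `T` levels with
`n` vertices each. -/
abbrev Vert (V : Type u) (T n : ℕ) : Type u := V × Fin T × Fin n

section Copy

variable {V : Type u} {l T n : ℕ}

/-- The vertex over `b` at the `t`-th of the levels that `g` selects over `b`, chosen by `o`. -/
def slot (g : V → Fin l ↪o Fin T) (o : V × Fin l → Fin n) (σ : V × Fin l) : Vert V T n :=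
  (σ.1, g σ.1 σ.2, o σ)

open Classical in
/-- The points of a stretched copy of a digraph on `V` with root `x`: the vertex of `V` below `x` is
represented by `x` alone (for each `t`), each other vertex `b` by the `l` vertices `slot g o (b, t)`
above it. -/
noncomputable def copyPoint (x : Vert V T n) (g : V → Fin l ↪o Fin T) (o : V × Fin l → Fin n)
    (b : V) (t : Fin l) : Vert V T n :=
  if b = x.1 then x else slot g o (b, t)

/-- The arcs of a stretched copy of `D`: each vertex `b` of `D` not below the root becomes a
directed path with `l` vertices on increasing levels, and an arc `b → c` of `D` becomes an arc
from the last point over `b` to the first point over `c`. -/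
def CopyAdj (D : Digraph V) (x : Vert V T n) (g : V → Fin l ↪o Fin T) (o : V × Fin l → Fin n)
    (y z : Vert V T n) : Prop :=
  (∃ b c, ∃ s t : Fin l, D.Adj b c ∧ (s : ℕ) + 1 = l ∧ (t : ℕ) = 0 ∧
    y = copyPoint x g o b s ∧ z = copyPoint x g o c t) ∨
  ∃ b, ∃ s t : Fin l, b ≠ x.1 ∧ (s : ℕ) + 1 = t ∧ y = copyPoint x g o b s ∧ z = copyPoint x g o b t

variable {D : Digraph V} {x : Vert V T n} {g : V → Fin l ↪o Fin T} {o : V × Fin l → Fin n}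

theorem copyPoint_of_eq {b : V} (h : b = x.1) (t : Fin l) : copyPoint x g o b t = x := if_pos h

theorem copyPoint_of_ne {b : V} (h : b ≠ x.1) (t : Fin l) :
    copyPoint x g o b t = slot g o (b, t) := if_neg h

@[simp]
theorem copyPoint_fst (b : V) (t : Fin l) : (copyPoint x g o b t).1 = b := by
  by_cases h : b = x.1
  · rw [copyPoint_of_eq h, h]
  · rw [copyPoint_of_ne h, slot]

theorem copyPoint_eq_or (b : V) (t : Fin l) :
    copyPoint x g o b t = x ∨ copyPoint x g o b t = slot g o (b, t) := by
  by_cases h : b = x.1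
  · exact .inl (copyPoint_of_eq h t)
  · exact .inr (copyPoint_of_ne h t)

theorem CopyAdj.exists_copyPoint {y z : Vert V T n} (h : CopyAdj D x g o y z) :
    (∃ b t, y = copyPoint x g o b t) ∧ ∃ b t, z = copyPoint x g o b t := by
  rcases h with ⟨b, c, s, t, _, _, _, hy, hz⟩ | ⟨b, s, t, _, _, hy, hz⟩
  · exact ⟨⟨b, s, hy⟩, c, t, hz⟩
  · exact ⟨⟨b, s, hy⟩, b, t, hz⟩

theorem CopyAdj.adj_or_level_lt {y z : Vert V T n} (h : CopyAdj D x g o y z) :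
    D.Adj y.1 z.1 ∨ (y.1 = z.1 ∧ y.2.1 < z.2.1) := by
  rcases h with ⟨b, c, s, t, hbc, _, _, rfl, rfl⟩ | ⟨b, s, t, hb, hst, rfl, rfl⟩
  · simpa using Or.inl hbc
  · right
    rw [copyPoint_of_ne hb, copyPoint_of_ne hb]
    have hlt : s < t := by
      rw [Fin.lt_def]
      omega
    exact ⟨rfl, (g b).strictMono hlt⟩

/-- Every closed walk in a stretched copy traverses one of the paths entirely, so it has at least
`l` steps. -/
theorem le_of_reachIn_copyAdj (hD : D.Loopless) {m : ℕ} (hm : 0 < m) {y : Vert V T n}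
    (h : ReachIn (CopyAdj D x g o) m y y) : l ≤ m := by
  classical
  -- The position of a point on its path; the root counts as one step beyond the end of a path.
  set p : Vert V T n → ℕ :=
    fun z => if z.1 = x.1 then l else (Finset.univ.filter fun t => g z.1 t < z.2.1).card with hp
  have hp1 : ∀ b t, b = x.1 → p (copyPoint x g o b t) = l := by
    intro b t hb
    simp [hp, hb]
  have hp2 : ∀ b (t : Fin l), b ≠ x.1 → p (copyPoint x g o b t) = t := by
    intro b t hb
    have : (Finset.univ.filter fun s => s < t) = Finset.Iio t := by ext; simp
    simp only [hp, copyPoint_fst, hb, if_false]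
    simp [copyPoint_of_ne hb, slot, this]
  -- A step advances by one, or leads from the end of a path, or beyond it, to a first point.
  have hstep : ∀ y z, CopyAdj D x g o y z → p z = p y + 1 ∨ (p z = 0 ∧ l ≤ p y + 1) := by
    rintro _ _ (⟨b, c, s, t, hbc, hs, ht, rfl, rfl⟩ | ⟨b, s, t, hb, hst, rfl, rfl⟩)
    · have hne : b ≠ c := fun h => hD c (h ▸ hbc)
      by_cases hc : c = x.1
      · rw [hp1 c t hc, hp2 b s (hc ▸ hne)]
        omega
      · rw [hp2 c t hc]
        by_cases hb : b = x.1
        · rw [hp1 b s hb]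
          omega
        · rw [hp2 b s hb]
          omega
    · rw [hp2 b s hb, hp2 b t hb]
      omega
  have key : ∀ m y z, ReachIn (CopyAdj D x g o) m y z → p z = p y + m ∨ p z + l ≤ p y + m := by
    intro m
    induction m with
    | zero =>
      rintro y z (rfl : y = z)
      exact .inl rfl
    | succ m ih =>
      rintro y z ⟨w, hyw, hwz⟩
      rcases hstep y w hyw with h1 | h1 <;> rcases ih w z hwz with h2 | h2 <;> omega
  rcases key m y y h with h1 | h1 <;> omega

/-- If an acyclic homomorphism of a digraph that contains a stretched copy of `D` is constant on the
points over each vertex of `D`, then the values on the copy are an acyclic homomorphism of `D`: each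
closed walk of `D` lifts to the copy. -/
theorem isAcyclicHom_of_copy {U : Type v} {C : Digraph U} {E : Digraph (Vert V T n)} (hl : 0 < l)
    (hE : ∀ y z, CopyAdj D x g o y z → E.Adj y z) {φ : Vert V T n → U} (hφ : E.IsAcyclicHom C φ)
    {f : V → U} (hf : ∀ b t, φ (copyPoint x g o b t) = f b) : D.IsAcyclicHom C f := by
  have hcross : ∀ b c, D.Adj b c →
      E.Adj (copyPoint x g o b ⟨l - 1, by omega⟩) (copyPoint x g o c ⟨0, hl⟩) := fun b c hbc =>
    hE _ _ (.inl ⟨b, c, _, _, hbc, by simp only; omega, rfl, rfl, rfl⟩)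
  refine isAcyclicHom_of_not_transGen (fun b c hbc => ?_) fun col a ha => ?_
  · simpa only [hf] using hφ.map_adj _ _ (hcross b c hbc)
  · refine hφ.not_transGen col (copyPoint x g o a ⟨0, hl⟩) ?_
    refine ha.lift' (fun b => copyPoint x g o b ⟨0, hl⟩) ?_
    rintro b c ⟨hbc, hb, hc⟩
    have hpath : ∀ t (ht : t < l), Relation.ReflTransGen
        (fun y z => E.Adj y z ∧ φ y = col ∧ φ z = col)
        (copyPoint x g o b ⟨0, hl⟩) (copyPoint x g o b ⟨t, ht⟩) := by
      intro t
      induction t with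
      | zero => exact fun _ => .refl
      | succ t ih =>
        intro ht
        by_cases hbx : b = x.1
        · rw [copyPoint_of_eq hbx, copyPoint_of_eq hbx]
        · refine (ih (by omega)).tail ⟨hE _ _ (.inr ⟨b, ⟨t, by omega⟩, ⟨t + 1, ht⟩, hbx, rfl,
            rfl, rfl⟩), ?_, ?_⟩ <;> simp only [hf, hb]
    exact .tail' (hpath _ _) ⟨hcross b c hbc, by simp only [hf, hb], by simp only [hf, hc]⟩

end Copy

section Union

variable {α : Type*} {R Q : α → α → Prop} {s : Set α} {l : ℕ}

theorem ReachIn.append {m m' : ℕ} {a b c : α} (h : ReachIn R m a b) (h' : ReachIn R m' b c) :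
    ReachIn R (m + m') a c := by
  induction m' generalizing b m with
  | zero =>
    obtain rfl : b = c := h'
    exact h
  | succ k ih =>
    obtain ⟨d, hbd, hdc⟩ := h'
    have := ih (h.snoc hbd) hdc
    rwa [show m + (k + 1) = m + 1 + k by omega]

/-- Adding a digraph without short closed walks on a set `s` of vertices creates no short closed
walk if no short walk connects two vertices of `s`. -/
theorem not_reachIn_union (hQs : ∀ a b, Q a b → a ∈ s ∧ b ∈ s)
    (hsep : ∀ a ∈ s, ∀ b ∈ s, ∀ m < l, ReachIn R m a b → a = b)
    (hR : ∀ m, 0 < m → m < l → ∀ a, ¬ ReachIn R m a a)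
    (hQ : ∀ m, 0 < m → m < l → ∀ a, ¬ ReachIn Q m a a) :
    ∀ m, 0 < m → m < l → ∀ a, ¬ ReachIn (fun a b => R a b ∨ Q a b) m a a := by
  have hzero : ∀ a ∈ s, ∀ b ∈ s, ∀ m < l, ReachIn R m a b → m = 0 ∧ a = b := by
    intro a ha b hb m hm h
    obtain rfl := hsep a ha b hb m hm h
    exact ⟨by_contra fun h0 => hR m (Nat.pos_of_ne_zero h0) hm a h, rfl⟩
  have hsplit : ∀ m < l, ∀ a, ∀ b ∈ s, ReachIn (fun a b => R a b ∨ Q a b) m a b →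
      ∃ i j, ∃ c ∈ s, i + j = m ∧ ReachIn R i a c ∧ ReachIn Q j c b := by
    intro m
    induction m with
    | zero =>
      rintro _ a b hb (rfl : a = b)
      exact ⟨0, 0, a, hb, rfl, rfl, rfl⟩
    | succ m ih =>
      rintro hm a b hb ⟨d, had, hdb⟩
      obtain ⟨i, j, c, hc, hij, hdc, hcb⟩ := ih (by omega) d b hb hdb
      rcases had with had | had
      · exact ⟨i + 1, j, c, hc, by omega, ⟨d, had, hdc⟩, hcb⟩
      · obtain ⟨rfl, rfl⟩ := hzero d (hQs _ _ had).2 c hc i (by omega) hdc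
        exact ⟨0, j + 1, a, (hQs _ _ had).1, by omega, rfl, d, had, hcb⟩
  have hfirst : ∀ m a b, ReachIn (fun a b => R a b ∨ Q a b) m a b → ReachIn R m a b ∨
      ∃ i j, ∃ c ∈ s, i + j = m ∧ ReachIn (fun a b => R a b ∨ Q a b) i a c ∧
        ReachIn (fun a b => R a b ∨ Q a b) j c b := by
    intro m
    induction m with
    | zero => exact fun a b h => .inl h
    | succ m ih =>
      rintro a b ⟨d, had, hdb⟩
      rcases had with hR' | hQ'
      · rcases ih d b hdb with h | ⟨i, j, c, hc, hij, hdc, hcb⟩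
        · exact .inl ⟨d, hR', h⟩
        · exact .inr ⟨i + 1, j, c, hc, by omega, ⟨d, .inl hR', hdc⟩, hcb⟩
      · exact .inr ⟨0, m + 1, a, (hQs _ _ hQ').1, by omega, rfl, d, .inr hQ', hdb⟩
  intro m hm hml a ha
  rcases hfirst m a a ha with h | ⟨i, j, c, hc, rfl, hac, hca⟩
  · exact hR m hm hml a h
  · obtain ⟨i', j', d, hd, hij, hcd, hdc⟩ := hsplit (j + i) (by omega) c c hc (hca.append hac)
    obtain ⟨rfl, rfl⟩ := hzero c hc d hd i' (by omega) hcd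
    exact hQ j' (by omega) (by omega) c hdc

end Union

end Digraph

/-! ### Families of stretched copies -/

namespace Digraph

/-- Indices of the copies: the root, the levels that are used, and a counter. -/
abbrev CopyIndex (V : Type u) (l T n d : ℕ) : Type u :=
  Vert V T n × (V → Fin l ↪o Fin T) × Fin d

section Family

variable {V : Type u} {l T n d : ℕ}

/-- The union of the stretched copies of `D` with index in `S`. -/
def FamilyAdj (D : Digraph V) (S : Finset (CopyIndex V l T n d))
    (ω : CopyIndex V l T n d → V × Fin l → Fin n) (y z : Vert V T n) : Prop :=
  ∃ h ∈ S, CopyAdj D h.1 h.2.1 (ω h) y z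

/-- `y` and `z` are points of a common copy with index in `S`. -/
def Together (S : Finset (CopyIndex V l T n d)) (ω : CopyIndex V l T n d → V × Fin l → Fin n)
    (y z : Vert V T n) : Prop :=
  ∃ h ∈ S, (∃ b t, y = copyPoint h.1 h.2.1 (ω h) b t) ∧ ∃ b t, z = copyPoint h.1 h.2.1 (ω h) b t

open Classical in
/-- The number of copies with index in `S` that use `y` as a slot, i.e. other than as a root. -/
noncomputable def slotCount (S : Finset (CopyIndex V l T n d))
    (ω : CopyIndex V l T n d → V × Fin l → Fin n) (y : Vert V T n) : ℕ :=
  (S.filter fun h => ∃ σ, y = slot h.2.1 (ω h) σ).card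

open Classical in
/-- The vertices that can be reached from `y` in fewer than `l` steps, each within a copy. -/
noncomputable def near [Fintype V] (S : Finset (CopyIndex V l T n d))
    (ω : CopyIndex V l T n d → V × Fin l → Fin n) (y : Vert V T n) : Finset (Vert V T n) :=
  Finset.univ.filter fun z => ∃ i < l, ReachIn (Together S ω) i y z

theorem slotCount_eq (S : Finset (CopyIndex V l T n d))
    (ω : CopyIndex V l T n d → V × Fin l → Fin n) (y : Vert V T n)
    [DecidablePred fun h : CopyIndex V l T n d => ∃ σ, y = slot h.2.1 (ω h) σ] :
    slotCount S ω y = (S.filter fun h => ∃ σ, y = slot h.2.1 (ω h) σ).card := by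
  rw [slotCount]
  congr

/-- The invariant of the greedy construction: there are no closed walks with fewer than `l` steps,
and no vertex is used as a slot by more than `K` copies. -/
def Admissible (D : Digraph V) (K : ℕ) (S : Finset (CopyIndex V l T n d))
    (ω : CopyIndex V l T n d → V × Fin l → Fin n) : Prop :=
  (∀ m, 0 < m → m < l → ∀ a, ¬ ReachIn (FamilyAdj D S ω) m a a) ∧ ∀ y, slotCount S ω y ≤ K

variable {D : Digraph V} {S : Finset (CopyIndex V l T n d)}
  {ω : CopyIndex V l T n d → V × Fin l → Fin n}

theorem together_symm (y z : Vert V T n) (h : Together S ω y z) : Together S ω z y := by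
  obtain ⟨i, hi, hy, hz⟩ := h
  exact ⟨i, hi, hz, hy⟩

theorem mem_near_symm [Fintype V] {y z : Vert V T n} (h : z ∈ near S ω y) : y ∈ near S ω z := by
  simp only [near, Finset.mem_filter, Finset.mem_univ, true_and] at h ⊢
  obtain ⟨i, hi, h⟩ := h
  exact ⟨i, hi, h.symm together_symm⟩

theorem FamilyAdj.together (y z : Vert V T n) (h : FamilyAdj D S ω y z) : Together S ω y z := by
  obtain ⟨i, hi, h⟩ := h
  exact ⟨i, hi, h.exists_copyPoint⟩

open Finset in
theorem card_together_le [Fintype V] {K : ℕ}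
    (hK : ∀ y, slotCount S ω y ≤ K) (y : Vert V T n) [DecidablePred (Together S ω y)] :
    #{z | Together S ω y z} ≤
      (K + Nat.card (V → Fin l ↪o Fin T) * d) * (Fintype.card V * l) := by
  classical
  set I := S.filter fun h => ∃ b t, y = copyPoint h.1 h.2.1 (ω h) b t with hI
  have hIcard : #I ≤ K + Nat.card (V → Fin l ↪o Fin T) * d := by
    have hsub : I ⊆ (S.filter fun h => ∃ σ, y = slot h.2.1 (ω h) σ) ∪
        (({y} : Finset (Vert V T n)) ×ˢ univ) := by
      intro h hh
      obtain ⟨hS, b, t, hbt⟩ := mem_filter.mp hh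
      rcases copyPoint_eq_or (x := h.1) (g := h.2.1) (o := ω h) b t with h1 | h1
      · refine mem_union_right _ (mem_product.mpr ⟨?_, mem_univ _⟩)
        rw [mem_singleton, hbt, h1]
      · exact mem_union_left _ (mem_filter.mpr ⟨hS, _, hbt.trans h1⟩)
    refine (card_le_card hsub).trans ((card_union_le _ _).trans (add_le_add ?_ ?_))
    · exact (slotCount_eq S ω y).symm.trans_le (hK y)
    · simp
  have hsub : univ.filter (Together S ω y) ⊆ I.biUnion fun h =>
      univ.image fun p : V × Fin l => copyPoint h.1 h.2.1 (ω h) p.1 p.2 := by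
    intro z hz
    obtain ⟨h, hS, hy, b, t, hz⟩ := (mem_filter.mp hz).2
    exact mem_biUnion.mpr ⟨h, mem_filter.mpr ⟨hS, hy⟩, mem_image.mpr ⟨(b, t), mem_univ _, hz.symm⟩⟩
  refine (card_le_card hsub).trans ((card_biUnion_le_card_mul _ _ _ fun h _ => ?_).trans
    (Nat.mul_le_mul_right _ hIcard))
  exact card_image_le.trans (by simp)

open Finset in
theorem card_reachIn_le {α : Type*} [Fintype α] {R : α → α → Prop} [∀ a, DecidablePred (R a)]
    [∀ m a, DecidablePred (ReachIn R m a)] {Δ : ℕ} (hR : ∀ a, #{b | R a b} ≤ Δ) (m : ℕ) (a : α) :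
    #{b | ReachIn R m a b} ≤ Δ ^ m := by
  classical
  induction m generalizing a with
  | zero =>
    have : univ.filter (ReachIn R 0 a) ⊆ {a} := by
      intro b hb
      exact mem_singleton.mpr (Eq.symm (mem_filter.mp hb).2)
    simpa using card_le_card this
  | succ m ih =>
    have : univ.filter (ReachIn R (m + 1) a) ⊆
        (univ.filter (R a)).biUnion fun c => univ.filter (ReachIn R m c) := by
      intro b hb
      obtain ⟨c, hac, hcb⟩ := (mem_filter.mp hb).2
      exact mem_biUnion.mpr ⟨c, by simpa using hac, by simpa using hcb⟩
    refine (card_le_card this).trans ((card_biUnion_le_card_mul _ _ _ fun c _ => ih c).trans ?_)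
    rw [pow_succ']
    exact Nat.mul_le_mul_right _ (hR a)

open Finset in
theorem card_near_le [Fintype V] {K : ℕ} (hK : ∀ y, slotCount S ω y ≤ K) (y : Vert V T n) :
    #(near S ω y) ≤ ∑ i ∈ range l,
      ((K + Nat.card (V → Fin l ↪o Fin T) * d) * (Fintype.card V * l)) ^ i := by
  classical
  have : near S ω y ⊆ (range l).biUnion fun i => univ.filter (ReachIn (Together S ω) i y) := by
    intro z hz
    obtain ⟨i, hi, h⟩ := (mem_filter.mp hz).2
    exact mem_biUnion.mpr ⟨i, mem_range.mpr hi, by simpa using h⟩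
  refine (card_le_card this).trans (card_biUnion_le.trans (sum_le_sum fun i _ => ?_))
  exact card_reachIn_le (fun a => card_together_le hK a) i y

open Finset in
theorem card_full_mul_le [Fintype V] (K : ℕ) :
    #{y | K ≤ slotCount S ω y} * K ≤ #S * (Fintype.card V * l) := by
  classical
  calc #{y | K ≤ slotCount S ω y} * K ≤ ∑ y with K ≤ slotCount S ω y, slotCount S ω y := by
        simpa using card_nsmul_le_sum (univ.filter fun y => K ≤ slotCount S ω y)
          (slotCount S ω) K fun y hy => (mem_filter.mp hy).2
    _ ≤ ∑ y, slotCount S ω y := sum_le_sum_of_subset (filter_subset _ _)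
    _ = ∑ h ∈ S, #{y | ∃ σ, y = slot h.2.1 (ω h) σ} := by
        simp only [slotCount_eq, card_filter]
        exact sum_comm
    _ ≤ ∑ h ∈ S, Fintype.card V * l := sum_le_sum fun h _ => by
        have : (univ.filter fun y => ∃ σ, y = slot h.2.1 (ω h) σ) ⊆
            univ.image (slot h.2.1 (ω h)) := by
          intro y hy
          obtain ⟨σ, hσ⟩ := (mem_filter.mp hy).2
          exact mem_image.mpr ⟨σ, mem_univ _, hσ.symm⟩
        exact (card_le_card this).trans (card_image_le.trans (by simp))
    _ = #S * (Fintype.card V * l) := by simp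

open Finset in
/-- A copy may be added to an admissible family if its slots are not yet in `K` copies and its
points are far apart. -/
theorem Admissible.insert_copy [Fintype V] [DecidableEq V] {K : ℕ} (hD : D.Loopless)
    (hS : Admissible D K S ω) {h : CopyIndex V l T n d} (hh : h ∉ S) {o : V × Fin l → Fin n}
    (hcap : ∀ σ, slotCount S ω (slot h.2.1 o σ) < K)
    (hroot : ∀ σ, slot h.2.1 o σ ∉ near S ω h.1)
    (hslot : ∀ σ τ, σ ≠ τ → slot h.2.1 o τ ∉ near S ω (slot h.2.1 o σ)) :
    Admissible D K (insert h S) (Function.update ω h o) := by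
  classical
  have hne : ∀ h' ∈ S, h' ≠ h := fun h' hh' he => hh (he ▸ hh')
  have hup : ∀ h' ∈ S, Function.update ω h o h' = ω h' := fun h' hh' =>
    Function.update_of_ne (hne h' hh') _ _
  refine ⟨?_, fun y => ?_⟩
  · have hadj : ∀ y z, FamilyAdj D (insert h S) (Function.update ω h o) y z →
        FamilyAdj D S ω y z ∨ CopyAdj D h.1 h.2.1 o y z := by
      rintro y z ⟨h', hh', hyz⟩
      rcases mem_insert.mp hh' with rfl | hh'
      · rw [Function.update_self] at hyz
        exact .inr hyz
      · rw [hup h' hh'] at hyz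
        exact .inl ⟨h', hh', hyz⟩
    have key := not_reachIn_union (l := l) (R := FamilyAdj D S ω) (Q := CopyAdj D h.1 h.2.1 o)
      (s := {y | ∃ b t, y = copyPoint h.1 h.2.1 o b t}) (fun y z hyz => hyz.exists_copyPoint) ?_
      hS.1 (fun m hm hml y hy => absurd (le_of_reachIn_copyAdj hD hm hy) (by omega))
    · exact fun m hm hml y hy => key m hm hml y (hy.mono hadj)
    · rintro y ⟨b, t, hy⟩ z ⟨c, s, hz⟩ m hm hw
      have hnear : z ∈ near S ω y := by
        simp only [near, mem_filter, mem_univ, true_and]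
        exact ⟨m, hm, hw.mono FamilyAdj.together⟩
      rcases copyPoint_eq_or (x := h.1) (g := h.2.1) (o := o) b t with h1 | h1 <;>
        rcases copyPoint_eq_or (x := h.1) (g := h.2.1) (o := o) c s with h2 | h2 <;>
        rw [h1] at hy <;> rw [h2] at hz <;> subst hy hz
      · rfl
      · exact absurd hnear (hroot _)
      · exact absurd (mem_near_symm hnear) (hroot _)
      · by_contra hne'
        exact hslot _ _ (fun he => hne' (by rw [he])) hnear
  · have hfilter : (S.filter fun h' => ∃ σ, y = slot h'.2.1 (Function.update ω h o h') σ) =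
        S.filter fun h' => ∃ σ, y = slot h'.2.1 (ω h') σ :=
      filter_congr fun h' hh' => by rw [hup h' hh']
    by_cases hy : ∃ σ, y = slot h.2.1 o σ
    · have h1 : slotCount S ω y < K := by
        obtain ⟨σ, rfl⟩ := hy
        exact hcap σ
      rw [slotCount_eq] at h1
      have h2 := card_insert_le h (S.filter fun h' => ∃ τ, y = slot h'.2.1 (ω h') τ)
      rw [slotCount_eq, filter_insert, if_pos (by rwa [Function.update_self]), hfilter]
      omega
    · rw [slotCount_eq, filter_insert, if_neg (by rwa [Function.update_self]), hfilter,
        ← slotCount_eq]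
      exact hS.2 y

open Finset in
/-- Most choices of a new copy are allowed. -/
theorem Admissible.exists_extensions [Fintype V] [DecidableEq V] {K : ℕ} (hD : D.Loopless)
    (hS : Admissible D K S ω) {h : CopyIndex V l T n d} (hh : h ∉ S) {κ β : ℝ}
    (hκ : (#{y | K ≤ slotCount S ω y} : ℝ) ≤ κ) (hβ : ∀ y, (#(near S ω y) : ℝ) ≤ β) (s : ℕ)
    (hs : Fintype.card (V × Fin l) = s) :
    ∃ A : Finset (V × Fin l → Fin n),
      (n : ℝ) * n ^ s - (s * κ + s * β + s * s * β) * n ^ s ≤ #A * n ∧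
      ∀ o ∈ A, Admissible D K (insert h S) (Function.update ω h o) := by
  classical
  set A : Finset (V × Fin l → Fin n) := univ.filter fun o =>
    (∀ σ, slotCount S ω (slot h.2.1 o σ) < K) ∧ (∀ σ, slot h.2.1 o σ ∉ near S ω h.1) ∧
    ∀ σ τ, σ ≠ τ → slot h.2.1 o τ ∉ near S ω (slot h.2.1 o σ) with hA
  refine ⟨A, ?_, fun o ho => ?_⟩
  · have hinj : ∀ (F : Finset (Vert V T n)) (σ : V × Fin l),
        #{y : Fin n | (σ.1, h.2.1 σ.1 σ.2, y) ∈ F} ≤ #F := fun F σ =>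
      card_le_card_of_injOn (fun y => (σ.1, h.2.1 σ.1 σ.2, y))
        (fun y hy => by simpa using hy) fun y _ z _ hyz => by simpa using hyz
    have hinjR : ∀ (F : Finset (Vert V T n)) (σ : V × Fin l) (b : ℝ), (#F : ℝ) ≤ b →
        (#{y : Fin n | (σ.1, h.2.1 σ.1 σ.2, y) ∈ F} : ℝ) ≤ b := fun F σ b hb =>
      le_trans (by exact_mod_cast hinj F σ) hb
    set F := univ.filter fun y => K ≤ slotCount S ω y with hF
    set B1 : V × Fin l → Finset (V × Fin l → Fin n) := fun σ =>
      {o | o σ ∈ (univ.filter fun y : Fin n => (σ.1, h.2.1 σ.1 σ.2, y) ∈ F)} with hB1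
    set B2 : V × Fin l → Finset (V × Fin l → Fin n) := fun σ =>
      {o | o σ ∈ (univ.filter fun y : Fin n => (σ.1, h.2.1 σ.1 σ.2, y) ∈ near S ω h.1)} with hB2
    set N3 : V × Fin l → V × Fin l → (V × Fin l → Fin n) → Finset (Fin n) := fun σ τ o =>
      if σ = τ then ∅ else univ.filter fun y : Fin n =>
        (τ.1, h.2.1 τ.1 τ.2, y) ∈ near S ω (slot h.2.1 o σ) with hN3
    set B3 : V × Fin l → V × Fin l → Finset (V × Fin l → Fin n) := fun σ τ =>
      {o | o τ ∈ N3 σ τ o} with hB3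
    have h1 : ∀ σ, (#(B1 σ) : ℝ) * n ≤ κ * (n : ℝ) ^ s := fun σ => by
      rw [← hs]
      exact card_coord_mem_le σ (fun _ => _) (fun _ _ => rfl) κ fun _ => hinjR F σ κ hκ
    have h2 : ∀ σ, (#(B2 σ) : ℝ) * n ≤ β * (n : ℝ) ^ s := fun σ => by
      rw [← hs]
      exact card_coord_mem_le σ (fun _ => _) (fun _ _ => rfl) β fun _ => hinjR _ σ β (hβ _)
    have h3 : ∀ σ τ, (#(B3 σ τ) : ℝ) * n ≤ β * (n : ℝ) ^ s := fun σ τ => by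
      rw [← hs]
      refine card_coord_mem_le τ (N3 σ τ) (fun o y => ?_) β fun o => ?_
      · simp only [hN3]
        split_ifs with hστ
        · rfl
        · have : slot h.2.1 (Function.update o τ y) σ = slot h.2.1 o σ := by
            simp only [slot, Function.update_of_ne hστ]
          rw [this]
      · simp only [hN3]
        split_ifs with hστ
        · simpa using (Nat.cast_nonneg _).trans (hβ h.1)
        · exact hinjR _ τ β (hβ _)
    have hcover : Aᶜ ⊆ (univ.biUnion B1 ∪ univ.biUnion B2) ∪
        univ.biUnion fun σ => univ.biUnion (B3 σ) := by
      intro o ho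
      by_contra hcon
      simp only [mem_union, mem_biUnion, mem_univ, true_and, not_or, not_exists] at hcon
      obtain ⟨⟨c1, c2⟩, c3⟩ := hcon
      refine mem_compl.mp ho (mem_filter.mpr ⟨mem_univ _, fun σ => ?_, fun σ hσ => ?_,
        fun σ τ hστ hτ => ?_⟩)
      · have := c1 σ
        simp only [hB1, hF, mem_filter, mem_univ, true_and, not_le] at this
        exact this
      · refine c2 σ ?_
        simp only [hB2, mem_filter, mem_univ, true_and]
        exact hσ
      · refine c3 σ τ ?_
        simp only [hB3, hN3, if_neg hστ, mem_filter, mem_univ, true_and]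
        exact hτ
    have hcard : #Aᶜ ≤ ∑ σ, #(B1 σ) + ∑ σ, #(B2 σ) + ∑ σ, ∑ τ, #(B3 σ τ) := by
      refine (card_le_card hcover).trans ((card_union_le _ _).trans (add_le_add
        ((card_union_le _ _).trans (add_le_add card_biUnion_le card_biUnion_le)) ?_))
      exact card_biUnion_le.trans (sum_le_sum fun σ _ => card_biUnion_le)
    have hcardR : (#Aᶜ : ℝ) * n ≤ (s * κ + s * β + s * s * β) * n ^ s := by
      calc (#Aᶜ : ℝ) * n
          ≤ (∑ σ, #(B1 σ) + ∑ σ, #(B2 σ) + ∑ σ, ∑ τ, #(B3 σ τ) : ℕ) * (n : ℝ) := by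
            gcongr
        _ = ∑ σ, #(B1 σ) * (n : ℝ) + ∑ σ, #(B2 σ) * (n : ℝ) + ∑ σ, ∑ τ, #(B3 σ τ) * (n : ℝ) := by
            push_cast
            simp only [add_mul, sum_mul]
        _ ≤ ∑ _σ : V × Fin l, κ * (n : ℝ) ^ s + ∑ _σ : V × Fin l, β * (n : ℝ) ^ s +
            ∑ _σ : V × Fin l, ∑ _τ : V × Fin l, β * (n : ℝ) ^ s :=
            add_le_add (add_le_add (sum_le_sum fun σ _ => h1 σ) (sum_le_sum fun σ _ => h2 σ))
              (sum_le_sum fun σ _ => sum_le_sum fun τ _ => h3 σ τ)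
        _ = (s * κ + s * β + s * s * β) * n ^ s := by
            simp only [sum_const, card_univ, hs, nsmul_eq_mul]
            ring
    have htot : (#A : ℝ) + #Aᶜ = n ^ s := by
      have := card_add_card_compl A
      rw [Fintype.card_fun, hs, Fintype.card_fin] at this
      exact_mod_cast this
    have : (n : ℝ) * n ^ s = #A * n + #Aᶜ * n := by rw [← htot]; ring
    linarith
  · obtain ⟨_, h1, h2, h3⟩ := mem_filter.mp ho
    exact hS.insert_copy hD hh h1 h2 h3

end Family

end Digraph

/-! ### Existence of a well spread family of copies -/

namespace Digraph

/-- A bound on the expected number of sets `X` of `x` vertices such that every copy with its root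
in `X` has a slot in `X`, if each vertex is the root of `d` copies and each copy has `s` slots. -/
theorem choose_mul_pow_le {m s n d x : ℕ} (hn : 0 < n) (hd : 2 ≤ d) (hx : 0 < x) (hm : 0 < m)
    (hs : 0 < s) (hxn : x * (48 * m * s ^ 2) ≤ n) :
    ((m * n).choose x : ℝ) * (2 * s * x / n) ^ (x * d) ≤ (1 / 4) ^ x := by
  have hnR : (0 : ℝ) < n := by exact_mod_cast hn
  have hsR : (1 : ℝ) ≤ s := by exact_mod_cast hs
  have hmR : (1 : ℝ) ≤ m := by exact_mod_cast hm
  have hxR : (0 : ℝ) ≤ x := Nat.cast_nonneg x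
  have hxnR : (x : ℝ) * (48 * m * s ^ 2) ≤ n := by exact_mod_cast hxn
  have hbase : 2 * (s : ℝ) * x / n ≤ 1 := by
    rw [div_le_one hnR]
    refine le_trans ?_ hxnR
    have h1 : (s : ℝ) ≤ s ^ 2 := by nlinarith
    have h2 : (s : ℝ) ^ 2 ≤ m * s ^ 2 := by nlinarith [sq_nonneg (s : ℝ)]
    nlinarith
  have hbase0 : 0 ≤ 2 * (s : ℝ) * x / n := by positivity
  -- The number of sets of size `x` is at most `(e * m * n / x) ^ x`.
  have hstir : (x : ℝ) ^ x / x.factorial ≤ 3 ^ x := by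
    refine (Real.pow_div_factorial_le_exp x hxR x).trans ?_
    rw [← Real.exp_one_pow]
    gcongr
    exact Real.exp_one_lt_three.le
  calc ((m * n).choose x : ℝ) * (2 * s * x / n) ^ (x * d)
      ≤ ((m * n : ℕ) : ℝ) ^ x / x.factorial * (2 * s * x / n) ^ (x * 2) := by
        gcongr ?_ * ?_
        · exact Nat.choose_le_pow_div x (m * n)
        · exact pow_le_pow_of_le_one hbase0 hbase (Nat.mul_le_mul_left x hd)
    _ = (4 * m * s ^ 2 * x / n) ^ x * ((x : ℝ) ^ x / x.factorial) := by
        rw [mul_comm x 2, pow_mul (2 * (s : ℝ) * x / n) 2 x, div_mul_eq_mul_div, ← mul_pow,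
          ← mul_div_assoc, ← mul_pow]
        congr 2
        push_cast
        field_simp
        ring
    _ ≤ (4 * m * s ^ 2 * x / n) ^ x * 3 ^ x := by gcongr
    _ = (12 * m * s ^ 2 * x / n) ^ x := by
        rw [← mul_pow]
        congr 1
        ring
    _ ≤ (1 / 4) ^ x := by
        refine pow_le_pow_left₀ (by positivity) ?_ x
        rw [div_le_iff₀ hnR]
        linarith

open Finset in
theorem sum_small_sets_le {α : Type*} [Fintype α] {m s n d : ℕ} (hα : Fintype.card α = m * n)
    (hn : 0 < n) (hd : 2 ≤ d) (hm : 0 < m) (hs : 0 < s) :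
    ∑ X : Finset α with 0 < #X ∧ #X * (48 * m * s ^ 2) ≤ n, (2 * s * #X / n : ℝ) ^ (#X * d)
      ≤ 1 / 3 := by
  classical
  set f : ℕ → ℝ := fun x =>
    if 0 < x ∧ x * (48 * m * s ^ 2) ≤ n then (2 * s * x / n : ℝ) ^ (x * d) else 0 with hf
  have hgeom : ∀ N : ℕ, ∑ x ∈ range N, (1 / 4 : ℝ) ^ (x + 1) = (1 - (1 / 4) ^ N) / 3 := by
    intro N
    induction N with
    | zero => simp
    | succ N ih =>
      rw [sum_range_succ, ih]
      ring
  calc ∑ X : Finset α with 0 < #X ∧ #X * (48 * m * s ^ 2) ≤ n, (2 * s * #X / n : ℝ) ^ (#X * d)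
      = ∑ X ∈ (univ : Finset α).powerset, f #X := by
        rw [sum_filter, powerset_univ]
    _ = ∑ x ∈ range (m * n + 1), ((m * n).choose x : ℝ) * f x := by
        rw [sum_powerset_apply_card, card_univ, hα]
        simp only [nsmul_eq_mul]
    _ = ∑ x ∈ range (m * n), ((m * n).choose (x + 1) : ℝ) * f (x + 1) := by
        rw [sum_range_succ']
        simp [hf]
    _ ≤ ∑ x ∈ range (m * n), (1 / 4 : ℝ) ^ (x + 1) := by
        refine sum_le_sum fun x _ => ?_
        by_cases hx : (x + 1) * (48 * m * s ^ 2) ≤ n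
        · simp only [hf, if_pos (And.intro x.succ_pos hx)]
          exact choose_mul_pow_le hn hd x.succ_pos hm hs hx
        · simp only [hf, hx, and_false, if_false, mul_zero]
          positivity
    _ ≤ 1 / 3 := by
        rw [hgeom]
        have : (0 : ℝ) ≤ (1 / 4) ^ (m * n) := by positivity
        linarith

section Counting

variable {V : Type u} [Fintype V] [DecidableEq V] {l T n : ℕ}

open Finset in
theorem card_slots_not_mem_le {q s : ℕ} (hs : Fintype.card (V × Fin l) = s) (hq : 0 < q)
    (A : Finset (Vert V T n)) (a : V) (g : V → Fin l ↪o Fin T)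
    (hA : ∀ b, b ≠ a → ∀ t, n ≤ q * #{i : Fin n | (b, g b t, i) ∈ A}) :
    (#{o : V × Fin l → Fin n | ∃ σ, σ.1 ≠ a ∧ slot g o σ ∉ A} : ℝ) ≤
      (1 - 1 / (q : ℝ) ^ s) * (n : ℝ) ^ s := by
  classical
  set P : Finset (V × Fin l → Fin n) := Fintype.piFinset fun σ =>
    if σ.1 = a then univ else univ.filter fun i : Fin n => (σ.1, g σ.1 σ.2, i) ∈ A with hP
  have hPcard : n ^ s ≤ q ^ s * #P := by
    have h1 : ∏ _σ : V × Fin l, n ≤ ∏ σ : V × Fin l, (q *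
        #(if σ.1 = a then univ else univ.filter fun i : Fin n => (σ.1, g σ.1 σ.2, i) ∈ A)) := by
      refine prod_le_prod' fun σ _ => ?_
      split_ifs with h
      · simpa using Nat.le_mul_of_pos_left n hq
      · exact hA σ.1 h σ.2
    rw [prod_mul_distrib, prod_const, prod_const, card_univ, hs] at h1
    rwa [hP, Fintype.card_piFinset]
  have hsub : (univ.filter fun o : V × Fin l → Fin n => ∃ σ, σ.1 ≠ a ∧ slot g o σ ∉ A) ⊆ Pᶜ := by
    intro o ho
    obtain ⟨σ, hσ, hσA⟩ := (mem_filter.mp ho).2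
    rw [mem_compl]
    intro hmem
    have := Fintype.mem_piFinset.mp hmem σ
    rw [if_neg hσ, mem_filter] at this
    exact hσA this.2
  have htot : (#P : ℝ) + #Pᶜ = (n : ℝ) ^ s := by
    have := card_add_card_compl P
    rw [Fintype.card_fun, hs, Fintype.card_fin] at this
    exact_mod_cast this
  have hqs : (0 : ℝ) < (q : ℝ) ^ s := by positivity
  have hPR : (n : ℝ) ^ s / (q : ℝ) ^ s ≤ #P := by
    rw [div_le_iff₀ hqs, mul_comm]
    exact_mod_cast hPcard
  calc (#{o : V × Fin l → Fin n | ∃ σ, σ.1 ≠ a ∧ slot g o σ ∉ A} : ℝ) ≤ #Pᶜ := by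
        exact_mod_cast card_le_card hsub
    _ = (n : ℝ) ^ s - #P := by rw [← htot]; ring
    _ ≤ (n : ℝ) ^ s - (n : ℝ) ^ s / (q : ℝ) ^ s := by linarith
    _ = (1 - 1 / (q : ℝ) ^ s) * (n : ℝ) ^ s := by ring

open Finset in
theorem card_slots_mem_le {s : ℕ} (hs : Fintype.card (V × Fin l) = s) (hn : 0 < n)
    (X : Finset (Vert V T n)) (g : V → Fin l ↪o Fin T) :
    (#{o : V × Fin l → Fin n | ∃ σ, slot g o σ ∈ X} : ℝ) ≤ s * #X / n * (n : ℝ) ^ s := by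
  classical
  have hnR : (0 : ℝ) < n := by exact_mod_cast hn
  have hsub : (univ.filter fun o : V × Fin l → Fin n => ∃ σ, slot g o σ ∈ X) ⊆
      univ.biUnion fun σ => univ.filter fun o : V × Fin l → Fin n =>
        o σ ∈ univ.filter fun i : Fin n => (σ.1, g σ.1 σ.2, i) ∈ X := by
    intro o ho
    obtain ⟨σ, hσ⟩ := (mem_filter.mp ho).2
    simp only [mem_biUnion, mem_filter, mem_univ, true_and]
    exact ⟨σ, hσ⟩
  have hσ : ∀ σ : V × Fin l, (#{o : V × Fin l → Fin n |
      o σ ∈ univ.filter fun i : Fin n => (σ.1, g σ.1 σ.2, i) ∈ X} : ℝ) ≤ #X / n * (n : ℝ) ^ s := by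
    intro σ
    have hX : #{i : Fin n | (σ.1, g σ.1 σ.2, i) ∈ X} ≤ #X :=
      card_le_card_of_injOn (fun i => (σ.1, g σ.1 σ.2, i)) (fun i hi => by simpa using hi)
        fun i _ j _ hij => by simpa using hij
    have := card_coord_mem_le σ
      (fun _ => univ.filter fun i : Fin n => (σ.1, g σ.1 σ.2, i) ∈ X) (fun _ _ => rfl) #X
      fun _ => by exact_mod_cast hX
    rw [hs] at this
    rwa [div_mul_eq_mul_div, le_div_iff₀ hnR]
  calc (#{o : V × Fin l → Fin n | ∃ σ, slot g o σ ∈ X} : ℝ)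
      ≤ ∑ σ : V × Fin l, (#{o : V × Fin l → Fin n |
          o σ ∈ univ.filter fun i : Fin n => (σ.1, g σ.1 σ.2, i) ∈ X} : ℝ) := by
        exact_mod_cast (card_le_card hsub).trans card_biUnion_le
    _ ≤ ∑ _σ : V × Fin l, #X / n * (n : ℝ) ^ s := sum_le_sum fun σ _ => hσ σ
    _ = s * #X / n * (n : ℝ) ^ s := by
        rw [sum_const, card_univ, hs, nsmul_eq_mul]
        ring

end Counting

open Finset in
/-- There is a family of stretched copies of `D` whose union has no closed walk of fewer than `l`
steps and that has two expansion properties.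

* If a set `A` contains a proportion `1 / q` of the level `t` over `a` and of the levels that `g`
  selects over the other vertices of `D`, then `A` contains all points of some copy with levels
  `g` whose root is in the level `t` over `a`. The slots over `a` itself are not points of the
  copy.
* Every small nonempty set `X` contains the root of a copy that has no slot in `X`. -/
theorem exists_spread_family {V : Type u} [Fintype V] [DecidableEq V] [Nonempty V] {D : Digraph V}
    (hD : D.Loopless) {l T : ℕ} (hl : 0 < l) (hT : 0 < T) (g₀ : V → Fin l ↪o Fin T) {q : ℕ}
    (hq : 0 < q) :
    ∃ (n d : ℕ) (ω : CopyIndex V l T n d → V × Fin l → Fin n), 0 < n ∧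
      (∀ m, 0 < m → m < l → ∀ a, ¬ ReachIn (FamilyAdj D univ ω) m a a) ∧
      (∀ (A : Finset (Vert V T n)) (a : V) (t : Fin T) (g : V → Fin l ↪o Fin T),
        n ≤ q * #{i : Fin n | (a, t, i) ∈ A} →
        (∀ b, b ≠ a → ∀ r, n ≤ q * #{i : Fin n | (b, g b r, i) ∈ A}) →
        ∃ i, (a, t, i) ∈ A ∧ ∃ j, ∀ σ, σ.1 ≠ a → slot g (ω ((a, t, i), g, j)) σ ∈ A) ∧
      ∀ X : Finset (Vert V T n), X.Nonempty →
        #X * (48 * (Fintype.card V * T) * (Fintype.card V * l) ^ 2) ≤ n →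
        ∃ x ∈ X, ∃ j, ∀ σ, slot g₀ (ω (x, g₀, j)) σ ∉ X := by
  classical
  have hV : 0 < Fintype.card V := Fintype.card_pos
  set m := Fintype.card V * T with hm
  set s := Fintype.card V * l with hs
  set r := Nat.card (V → Fin l ↪o Fin T) with hr
  have hmpos : 0 < m := Nat.mul_pos hV hT
  have hspos : 0 < s := Nat.mul_pos hV hl
  have hslots : Fintype.card (V × Fin l) = s := by simp [hs]
  have hqs : (1 : ℝ) ≤ (q : ℝ) ^ s := one_le_pow₀ (by exact_mod_cast hq)
  -- A copy lies in a given large set with probability at least `2 * ρ`.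
  set ρ : ℝ := 1 / (2 * (q : ℝ) ^ s) with hρ
  have hρ0 : 0 < ρ := by positivity
  have hρ1 : ρ ≤ 1 / 2 := by
    rw [hρ]
    exact one_div_le_one_div_of_le (by norm_num) (by linarith)
  have hρq : 1 / (q : ℝ) ^ s = 2 * ρ := by
    rw [hρ]
    field_simp
  -- So many copies per root outweigh the number of sets of vertices.
  obtain ⟨d, hd2, hd⟩ : ∃ d : ℕ, 2 ≤ d ∧ (1 - ρ) ^ d ≤ (1 / 2) ^ (q * (m + 1)) := by
    obtain ⟨d, hd⟩ := exists_pow_lt_of_lt_one (show (0 : ℝ) < (1 / 2) ^ (q * (m + 1)) by positivity)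
      (show 1 - ρ < 1 by linarith)
    refine ⟨d + 2, by omega, le_trans ?_ hd.le⟩
    exact pow_le_pow_of_le_one (by linarith) (by linarith) (by omega)
  -- The cap on the number of copies that use a vertex, so large that few vertices reach it.
  obtain ⟨K, hK⟩ := exists_nat_gt (2 * (s * (m * r * d * s)) / ρ : ℝ)
  have hKpos : (0 : ℝ) < K := lt_of_le_of_lt (by positivity) hK
  rw [div_lt_iff₀ hρ0] at hK
  set β : ℕ := ∑ i ∈ range l, ((K + r * d) * s) ^ i with hβ
  obtain ⟨n, hn⟩ := exists_nat_gt
    (max 1 (max (2 * (s * β + s * s * β) / ρ) (2 * (Fintype.card V * T * r)) : ℝ))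
  have hn0 : 0 < n := by
    have := (le_max_left _ _).trans_lt hn
    exact_mod_cast zero_lt_one.trans this
  have hnR : (0 : ℝ) < n := by exact_mod_cast hn0
  have hnβ : 2 * (s * β + s * s * β) < (n : ℝ) * ρ := by
    rw [← div_lt_iff₀ hρ0]
    exact ((le_max_left _ _).trans (le_max_right _ _)).trans_lt hn
  have hnE : 2 * (Fintype.card V * T * r) < (n : ℝ) :=
    ((le_max_right _ _).trans (le_max_right _ _)).trans_lt hn
  have hns : (0 : ℝ) < (n : ℝ) ^ s := by positivity
  have hH : Fintype.card (CopyIndex V l T n d) = m * n * r * d := by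
    simp only [CopyIndex, Vert, Fintype.card_prod, Fintype.card_fin, hr, Nat.card_eq_fintype_card,
      hm]
    ring
  have hcard : Fintype.card (Vert V T n) = m * n := by
    simp only [Vert, Fintype.card_prod, Fintype.card_fin, hm]
    ring
  -- The events to be avoided: `E₁` for large sets, `E₂` for small sets. `R₁` and `R₂` are the
  -- copies that an event concerns, `Bad` are the choices for which a copy does not prevent the event, and
  -- `w` bounds the proportion of `Bad` among the allowed choices.
  set E₁ : Finset (Finset (Vert V T n) × V × Fin T × (V → Fin l ↪o Fin T)) :=
    univ.filter fun e => n ≤ q * #{i : Fin n | (e.2.1, e.2.2.1, i) ∈ e.1} ∧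
      ∀ b, b ≠ e.2.1 → ∀ t, n ≤ q * #{i : Fin n | (b, e.2.2.2 b t, i) ∈ e.1} with hE₁
  set E₂ : Finset (Finset (Vert V T n)) :=
    univ.filter fun X => 0 < #X ∧ #X * (48 * m * s ^ 2) ≤ n with hE₂
  set R₁ : Finset (Vert V T n) × V × Fin T × (V → Fin l ↪o Fin T) →
      Finset (CopyIndex V l T n d) := fun e =>
    (e.1.filter fun y => y.1 = e.2.1 ∧ y.2.1 = e.2.2.1) ×ˢ ({e.2.2.2} ×ˢ univ) with hR₁
  set R₂ : Finset (Vert V T n) → Finset (CopyIndex V l T n d) := fun X =>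
    X ×ˢ ({g₀} ×ˢ univ) with hR₂
  set Bad : (Finset (Vert V T n) × V × Fin T × (V → Fin l ↪o Fin T)) ⊕ Finset (Vert V T n) →
      CopyIndex V l T n d → Finset (V × Fin l → Fin n) := fun e h =>
    Sum.elim
      (fun e => if h ∈ R₁ e then
          univ.filter fun o => ∃ σ : V × Fin l, σ.1 ≠ e.2.1 ∧ slot e.2.2.2 o σ ∉ e.1
        else univ)
      (fun X => if h ∈ R₂ X then univ.filter fun o => ∃ σ, slot g₀ o σ ∈ X else univ) e with hBad
  set w : (Finset (Vert V T n) × V × Fin T × (V → Fin l ↪o Fin T)) ⊕ Finset (Vert V T n) →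
      CopyIndex V l T n d → ℝ := fun e h =>
    Sum.elim (fun e => if h ∈ R₁ e then 1 - ρ else 1)
      (fun X => if h ∈ R₂ X then (2 * s * #X / n : ℝ) else 1) e with hw
  suffices hchoice : ∃ ω, Admissible D K univ ω ∧ ∀ e ∈ E₁.disjSum E₂, ∃ h, ω h ∉ Bad e h by
    obtain ⟨ω, hω, havoid⟩ := hchoice
    refine ⟨n, d, ω, hn0, hω.1, fun A a t g h1 h2 => ?_, fun X hX hXn => ?_⟩
    · obtain ⟨h, hh⟩ := havoid (.inl (A, a, t, g))
        (inl_mem_disjSum.mpr (mem_filter.mpr ⟨mem_univ _, h1, h2⟩))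
      simp only [hBad, Sum.elim_inl] at hh
      split_ifs at hh with hmem
      · simp only [hR₁, mem_product, mem_filter, mem_singleton, mem_univ, and_true] at hmem
        obtain ⟨⟨hhA, rfl, rfl⟩, rfl⟩ := hmem
        refine ⟨h.1.2.2, hhA, h.2.2, fun σ hσ => ?_⟩
        by_contra hcon
        exact hh (mem_filter.mpr ⟨mem_univ _, σ, hσ, hcon⟩)
      · exact absurd (mem_univ _) hh
    · obtain ⟨h, hh⟩ := havoid (.inr X)
        (inr_mem_disjSum.mpr (mem_filter.mpr ⟨mem_univ _, card_pos.mpr hX, hXn⟩))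
      simp only [hBad, Sum.elim_inr] at hh
      split_ifs at hh with hmem
      · simp only [hR₂, mem_product, mem_singleton, mem_univ, and_true] at hmem
        obtain ⟨hhX, hg⟩ := hmem
        refine ⟨h.1, hhX, h.2.2, fun σ hσ => hh (mem_filter.mpr ⟨mem_univ _, σ, ?_⟩)⟩
        rwa [← hg] at hσ ⊢
      · exact absurd (mem_univ _) hh
  refine exists_greedy_choice (Admissible D K) ((1 - ρ) * (n : ℝ) ^ s) w ?_ Bad
    (E₁.disjSum E₂) ?_ (fun _ _ => ⟨0, hn0⟩) ?_ (mul_pos (by linarith) hns) ?_ ?_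
  · rintro (e | X) h
    · simp only [hw, Sum.elim_inl]
      split_ifs <;> linarith
    · simp only [hw, Sum.elim_inr]
      split_ifs <;> positivity
  · rintro (e | X) he h
    · rw [inl_mem_disjSum, hE₁, mem_filter] at he
      simp only [hw, hBad, Sum.elim_inl]
      split_ifs with hmem
      · right
        refine (card_slots_not_mem_le hslots hq e.1 e.2.1 e.2.2.2 he.2.2).trans ?_
        rw [hρq, ← mul_assoc]
        exact mul_le_mul_of_nonneg_right (by nlinarith) hns.le
      · exact .inl le_rfl
    · simp only [hw, hBad, Sum.elim_inr]
      split_ifs with hmem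
      · right
        refine (card_slots_mem_le hslots hn0 X g₀).trans ?_
        rw [← mul_assoc]
        refine mul_le_mul_of_nonneg_right ?_ hns.le
        have : (0 : ℝ) ≤ s * #X / n := by positivity
        calc (s * #X / n : ℝ) = 2 * (s * #X / n) * (1 / 2) := by ring
          _ ≤ 2 * (s * #X / n) * (1 - ρ) := by gcongr; linarith
          _ = 2 * s * #X / n * (1 - ρ) := by ring
      · exact .inl le_rfl
  · refine ⟨fun k hk _ a ha => ?_, fun y => by simp [slotCount]⟩
    obtain ⟨k, rfl⟩ : ∃ i, k = i + 1 := ⟨k - 1, by omega⟩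
    obtain ⟨b, ⟨h, hh, _⟩, _⟩ := ha
    exact absurd hh (notMem_empty h)
  · intro S ω h hS hh
    have hκ : (#{y | K ≤ slotCount S ω y} : ℝ) ≤ m * n * r * d * s / K := by
      rw [le_div_iff₀ hKpos]
      have h1 := card_full_mul_le (S := S) (ω := ω) K
      have h2 : #S ≤ m * n * r * d := hH ▸ card_le_univ S
      exact_mod_cast h1.trans (Nat.mul_le_mul_right _ h2)
    obtain ⟨A, hA, hA'⟩ := hS.exists_extensions hD hh hκ
      (fun y => by exact_mod_cast card_near_le hS.2 y : ∀ y, (#(near S ω y) : ℝ) ≤ β) s hslots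
    refine ⟨A, ?_, fun o ho => ⟨Function.update ω h o, hA' o ho, Function.update_self ..,
      fun h' hh' => Function.update_of_ne (fun he : h' = h => hh (he ▸ hh')) _ _⟩⟩
    have hsmall : s * (m * n * r * d * s / K) + s * β + s * s * β ≤ ρ * (n : ℝ) := by
      have : (s * (m * n * r * d * s / K) : ℝ) ≤ ρ / 2 * n := by
        have : (s * (m * n * r * d * s / K) : ℝ) = s * (m * r * d * s) / K * n := by ring
        rw [this]
        refine mul_le_mul_of_nonneg_right ?_ hnR.le
        rw [div_le_iff₀ hKpos]
        linarith
      linarith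
    refine le_of_mul_le_mul_right ?_ hnR
    nlinarith [mul_le_mul_of_nonneg_right hsmall hns.le]
  · have hprod₁ : ∀ e ∈ E₁, ∏ h, w (.inl e) h ≤ (1 / 2) ^ ((m + 1) * n) := by
      intro e he
      have hcardR : n ≤ q * #(e.1.filter fun y => y.1 = e.2.1 ∧ y.2.1 = e.2.2.1) := by
        refine (mem_filter.mp he).2.1.trans (Nat.mul_le_mul_left q ?_)
        refine card_le_card_of_injOn (fun i => (e.2.1, e.2.2.1, i)) (fun i hi => ?_)
          fun i _ j _ hij => by simpa using hij
        simpa using hi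
      have h1 : ∏ h, w (.inl e) h = (1 - ρ) ^ #(R₁ e) := by
        simp only [hw, Sum.elim_inl]
        rw [prod_ite_mem, univ_inter, prod_const]
      have h2 : #(R₁ e) = d * #(e.1.filter fun y => y.1 = e.2.1 ∧ y.2.1 = e.2.2.1) := by
        simp [hR₁, card_product, mul_comm]
      rw [h1, h2, pow_mul]
      refine (pow_le_pow_left₀ (pow_nonneg (by linarith) _) hd _).trans ?_
      rw [← pow_mul]
      refine pow_le_pow_of_le_one (by norm_num) (by norm_num) ?_
      calc (m + 1) * n ≤ (m + 1) * (q * _) := Nat.mul_le_mul_left _ hcardR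
        _ = _ := by ring
    have hprod₂ : ∀ X, ∏ h, w (.inr X) h = (2 * s * #X / n : ℝ) ^ (#X * d) := by
      intro X
      simp only [hw, Sum.elim_inr]
      rw [prod_ite_mem, univ_inter, prod_const]
      congr 1
      simp [hR₂, card_product]
    have hsum₁ : ∑ e ∈ E₁, ∏ h, w (.inl e) h ≤ 1 / 2 := by
      have hcardE : (#E₁ : ℝ) ≤ 2 ^ (m * n) * (Fintype.card V * T * r) := by
        have : #E₁ ≤ 2 ^ (m * n) * (Fintype.card V * T * r) := by
          refine (card_le_univ E₁).trans (le_of_eq ?_)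
          rw [Fintype.card_prod, Fintype.card_finset, hcard, Fintype.card_prod, Fintype.card_prod,
            Fintype.card_fin, hr, Nat.card_eq_fintype_card]
          ring
        exact_mod_cast this
      have h2n : (n : ℝ) ≤ 2 ^ n := by exact_mod_cast Nat.lt_two_pow_self.le
      calc ∑ e ∈ E₁, ∏ h, w (.inl e) h ≤ ∑ _e ∈ E₁, (1 / 2 : ℝ) ^ ((m + 1) * n) :=
            sum_le_sum hprod₁
        _ = #E₁ * (1 / 2 : ℝ) ^ ((m + 1) * n) := by rw [sum_const, nsmul_eq_mul]
        _ ≤ 2 ^ (m * n) * (Fintype.card V * T * r) * (1 / 2 : ℝ) ^ ((m + 1) * n) := by gcongr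
        _ = Fintype.card V * T * r / 2 ^ n := by
            rw [add_mul, one_mul, pow_add, one_div, inv_pow, inv_pow]
            field_simp
        _ ≤ 1 / 2 := by
            rw [div_le_iff₀ (by positivity)]
            linarith
    have hsum₂ : ∑ X ∈ E₂, ∏ h, w (.inr X) h ≤ 1 / 3 := by
      simp only [hprod₂]
      exact sum_small_sets_le hcard hn0 hd2 hmpos hspos
    rw [sum_disjSum]
    linarith

end Digraph

/-! ### Majority colours -/

namespace Digraph

section Colouring

variable {V : Type u} {l T n : ℕ} {U : Type v} [Finite U]

open Finset in
/-- In each level over `b` some colour is used by a proportion `1 / k` of the vertices, and some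
colour is so in at least `l` of the `k * l` levels. -/
theorem exists_popular_colour [DecidableEq U] {k : ℕ} (hk : 0 < k) (hl : 0 < l) (hn : 0 < n)
    (hU : Nat.card U ≤ k) (φ : Vert V (k * l) n → U) (b : V) :
    ∃ (c : U) (g : Fin l ↪o Fin (k * l)), ∀ t, n ≤ k * #{i : Fin n | φ (b, g t, i) = c} := by
  have := Fintype.ofFinite U
  rw [Nat.card_eq_fintype_card] at hU
  have hlevel : ∀ t : Fin (k * l), ∃ c, n ≤ k * #{i : Fin n | φ (b, t, i) = c} := by
    intro t
    by_contra! hcon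
    have h1 : ∑ c : U, #{i : Fin n | φ (b, t, i) = c} = n := by
      have := card_eq_sum_card_fiberwise (f := fun i : Fin n => φ (b, t, i)) (s := univ)
        (t := univ) (fun _ _ => mem_coe.mpr (mem_univ _))
      rw [card_univ, Fintype.card_fin] at this
      exact this.symm
    have hne : (univ : Finset U).Nonempty := ⟨φ (b, t, ⟨0, hn⟩), mem_univ _⟩
    have h2 : ∑ c : U, k * #{i : Fin n | φ (b, t, i) = c} < ∑ _c : U, n :=
      sum_lt_sum_of_nonempty hne fun c _ => hcon c
    rw [← mul_sum, h1, sum_const, card_univ, smul_eq_mul] at h2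
    exact absurd h2 (not_lt.mpr (Nat.mul_le_mul_right n hU))
  choose c hc using hlevel
  obtain ⟨c₀, _, hc₀⟩ := exists_le_card_fiber_of_mul_le_card_of_maps_to (s := univ)
    (t := univ) (f := c) (n := l) (fun _ _ => mem_univ _)
    ⟨c ⟨0, Nat.mul_pos hk hl⟩, mem_univ _⟩ (by simpa using Nat.mul_le_mul_right l hU)
  refine ⟨c₀, orderEmbOfCardLe _ hc₀, fun t => ?_⟩
  simpa only [(mem_filter.mp (orderEmbOfCardLe_mem _ hc₀ t)).2] using
    hc (orderEmbOfCardLe _ hc₀ t)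

open Finset in
/-- If in each level each colour other than `f b` is used by a proportion of less than `1 / q` of
the vertices, then few vertices have an exceptional colour. -/
theorem mul_card_exceptional_le [Fintype V] [DecidableEq U] {k q : ℕ} (hU : Nat.card U ≤ k)
    (φ : Vert V T n → U) (f : V → U)
    (hf : ∀ b t c, n ≤ q * #{i : Fin n | φ (b, t, i) = c} → c = f b) :
    q * #{y | φ y ≠ f y.1} ≤ Fintype.card V * T * (k * n) := by
  classical
  have := Fintype.ofFinite U
  rw [Nat.card_eq_fintype_card] at hU
  have hlevel : ∀ p : V × Fin T, q * #{i : Fin n | φ (p.1, p.2, i) ≠ f p.1} ≤ k * n := by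
    intro p
    have hsub : (univ.filter fun i : Fin n => φ (p.1, p.2, i) ≠ f p.1) ⊆
        (univ.filter fun c => c ≠ f p.1).biUnion fun c =>
          univ.filter fun i : Fin n => φ (p.1, p.2, i) = c := by
      intro i hi
      simpa using hi
    calc q * #{i : Fin n | φ (p.1, p.2, i) ≠ f p.1}
        ≤ q * ∑ c with c ≠ f p.1, #{i : Fin n | φ (p.1, p.2, i) = c} :=
          Nat.mul_le_mul_left q ((card_le_card hsub).trans card_biUnion_le)
      _ = ∑ c with c ≠ f p.1, q * #{i : Fin n | φ (p.1, p.2, i) = c} := mul_sum ..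
      _ ≤ ∑ c with c ≠ f p.1, n := sum_le_sum fun c hc =>
          (not_le.mp fun h => (mem_filter.mp hc).2 (hf p.1 p.2 c h)).le
      _ ≤ k * n := by
          rw [sum_const, smul_eq_mul]
          exact Nat.mul_le_mul_right n ((card_le_univ _).trans hU)
  have hsub : (univ.filter fun y : Vert V T n => φ y ≠ f y.1) ⊆
      (univ : Finset (V × Fin T)).biUnion fun p =>
        (univ.filter fun i : Fin n => φ (p.1, p.2, i) ≠ f p.1).image fun i => (p.1, p.2, i) := by
    rintro ⟨b, t, i⟩ hy
    refine mem_biUnion.mpr ⟨(b, t), mem_univ _, mem_image.mpr ⟨i, ?_, rfl⟩⟩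
    simpa using hy
  calc q * #{y | φ y ≠ f y.1}
      ≤ q * ∑ p : V × Fin T, #{i : Fin n | φ (p.1, p.2, i) ≠ f p.1} :=
        Nat.mul_le_mul_left q ((card_le_card hsub).trans
          (card_biUnion_le.trans (sum_le_sum fun p _ => card_image_le)))
    _ = ∑ p : V × Fin T, q * #{i : Fin n | φ (p.1, p.2, i) ≠ f p.1} := mul_sum ..
    _ ≤ ∑ _p : V × Fin T, k * n := sum_le_sum fun p _ => hlevel p
    _ = Fintype.card V * T * (k * n) := by simp

end Colouring

theorem eq_of_isPointed {V : Type u} {U : Type v} [DecidableEq V] {D : Digraph V} {C : Digraph U}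
    (hC : C.IsPointed D) {f : V → U} (hf : D.IsAcyclicHom C f) {a : V} {c : U}
    (hfc : D.IsAcyclicHom C (Function.update f a c)) : c = f a := by
  by_contra hne
  refine hC ⟨f, Function.update f a c, hf, hfc, a, ?_, fun b hb => ?_⟩
  · simpa using Ne.symm hne
  · by_contra hba
    exact hb (Function.update_of_ne hba c f).symm

theorem isAcyclicHom_fst {V : Type u} {l T n d : ℕ} {D : Digraph V} (hD : D.Loopless)
    (S : Finset (CopyIndex V l T n d)) (ω : CopyIndex V l T n d → V × Fin l → Fin n) :
    (Digraph.mk (FamilyAdj D S ω)).IsAcyclicHom D Prod.fst := by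
  refine isAcyclicHom_of_not_transGen ?_ fun b y hy => ?_
  · rintro y z ⟨h, _, hyz⟩
    exact hyz.adj_or_level_lt.symm.imp And.left id
  · have key : ∀ z, Relation.TransGen
        (fun y z => FamilyAdj D S ω y z ∧ y.1 = b ∧ z.1 = b) y z → y.2.1 < z.2.1 := by
      have hstep : ∀ y z, FamilyAdj D S ω y z ∧ y.1 = b ∧ z.1 = b → y.2.1 < z.2.1 := by
        rintro y z ⟨⟨h, _, hyz⟩, hy, hz⟩
        rcases hyz.adj_or_level_lt with h' | h'
        · rw [hy, hz] at h'
          exact absurd h' (hD b)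
        · exact h'.2
      intro z hz
      induction hz with
      | single h => exact hstep _ _ h
      | tail _ h ih => exact ih.trans (hstep _ _ h)
    exact lt_irrefl _ (key y hy)

end Digraph

open Digraph Finset in
theorem theorem1 {V : Type u} [Finite V] (D : Digraph V) (hD : D.Loopless)
    (k l : ℕ) (hk : 0 < k) (hl : 0 < l) :
    ∃ (W : Type u) (_ : Finite W) (Dstar : Digraph W) (ψ : W → V),
      Dstar.Loopless ∧
      Function.Surjective ψ ∧
      Dstar.IsAcyclicHom D ψ ∧
      (l : ℕ∞) ≤ Dstar.girth ∧
      (∀ (U : Type v) [Finite U] (C : Digraph U), C.Loopless → Nat.card U ≤ k →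
        (Dstar.HomomorphicTo C ↔ D.HomomorphicTo C)) ∧
      (∀ (U : Type v) [Finite U] (C : Digraph U), C.Loopless → Nat.card U ≤ k →
        C.IsPointed D → ∀ φ : W → U, Dstar.IsAcyclicHom C φ →
          ∃! f : V → U, D.IsAcyclicHom C f ∧ φ = f ∘ ψ) := by
  classical
  have := Fintype.ofFinite V
  rcases isEmpty_or_nonempty V with hV | hV
  · have hhom : ∀ (U : Type v) (C : Digraph U) (f : V → U), D.IsAcyclicHom C f := fun U C f =>
      isAcyclicHom_of_not_transGen (fun a => isEmptyElim a) fun _ a => isEmptyElim a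
    refine ⟨V, inferInstance, D, id, hD, Function.surjective_id,
      isAcyclicHom_of_not_transGen (fun a => isEmptyElim a) fun _ a => isEmptyElim a,
      le_girth_of_not_reachIn fun _ _ _ a => isEmptyElim a, fun U _ C _ _ => Iff.rfl,
      fun U _ C _ _ _ φ _ => ⟨φ, ⟨hhom U C φ, rfl⟩, fun f _ => funext fun a => isEmptyElim a⟩⟩
  set m := Fintype.card V * (k * l) with hm
  set M := 48 * m * (Fintype.card V * l) ^ 2 with hM
  have hcV : 0 < Fintype.card V := Fintype.card_pos
  have hT : 0 < k * l := Nat.mul_pos hk hl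
  have hmpos : 0 < m := Nat.mul_pos hcV hT
  have hMpos : 0 < M := by positivity
  have hlT : l ≤ k * l := Nat.le_mul_of_pos_left l hk
  -- With this `q`, the vertices of exceptional colour form a set to which the expansion applies.
  set q := m * k * M with hq
  have hkq : k ≤ q := by
    rw [hq, mul_comm m k, mul_assoc]
    exact Nat.le_mul_of_pos_right k (Nat.mul_pos hmpos hMpos)
  obtain ⟨n, d, ω, hn, hcl, hlarge, hsmall⟩ := exists_spread_family hD hl hT
    (fun _ => Fin.castLEOrderEmb hlT) (hk.trans_le hkq)
  set E : Digraph (Vert V (k * l) n) := ⟨FamilyAdj D univ ω⟩ with hE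
  have hcopy : ∀ h : CopyIndex V l (k * l) n d, ∀ y z, CopyAdj D h.1 h.2.1 (ω h) y z → E.Adj y z :=
    fun h y z hyz => ⟨h, mem_univ _, hyz⟩
  have hψ : E.IsAcyclicHom D Prod.fst := isAcyclicHom_fst hD univ ω
  have hcopyHom : ∀ (U : Type v) (C : Digraph U) (φ : Vert V (k * l) n → U), E.IsAcyclicHom C φ →
      ∀ (f : V → U) (h : CopyIndex V l (k * l) n d),
      (∀ σ : V × Fin l, σ.1 ≠ h.1.1 → φ (slot h.2.1 (ω h) σ) = f σ.1) →
      D.IsAcyclicHom C (Function.update f h.1.1 (φ h.1)) := by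
    intro U C φ hφ f h hf
    refine isAcyclicHom_of_copy hl (hcopy h) hφ fun b t => ?_
    by_cases hb : b = h.1.1
    · rw [copyPoint_of_eq hb, hb, Function.update_self]
    · rw [copyPoint_of_ne hb, Function.update_of_ne hb]
      exact hf (b, t) hb
  have hpopular : ∀ (U : Type v) (C : Digraph U) (φ : Vert V (k * l) n → U), E.IsAcyclicHom C φ →
      ∀ (f : V → U) (g : V → Fin l ↪o Fin (k * l)),
      (∀ b r, n ≤ q * #{i : Fin n | φ (b, g b r, i) = f b}) →
      ∀ a t c, n ≤ q * #{i : Fin n | φ (a, t, i) = c} →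
      D.IsAcyclicHom C (Function.update f a c) := by
    intro U C φ hφ f g hg a t c hc
    obtain ⟨i, hi, j, hj⟩ := hlarge (univ.filter fun y => φ y = Function.update f a c y.1) a t g
      (by simpa using hc) fun b hb r => by simpa [Function.update_of_ne hb] using hg b r
    have hi' : φ (a, t, i) = c := by simpa using hi
    rw [← hi']
    refine hcopyHom U C φ hφ f ((a, t, i), g, j) fun σ hσ => ?_
    have h1 := (mem_filter.mp (hj σ hσ)).2
    rwa [show (slot g (ω ((a, t, i), g, j)) σ).1 = σ.1 from rfl, Function.update_of_ne hσ] at h1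
  -- The most frequent colours form an acyclic homomorphism of `D`.
  have hmajor : ∀ (U : Type v) [Finite U] (C : Digraph U), Nat.card U ≤ k →
      ∀ φ : Vert V (k * l) n → U, E.IsAcyclicHom C φ → ∃ f : V → U, D.IsAcyclicHom C f ∧
      ∀ a t c, n ≤ q * #{i : Fin n | φ (a, t, i) = c} →
        D.IsAcyclicHom C (Function.update f a c) := by
    intro U _ C hU φ hφ
    choose f g hg using exists_popular_colour hk hl hn hU φ
    have hg' : ∀ b r, n ≤ q * #{i : Fin n | φ (b, g b r, i) = f b} := fun b r =>
      (hg b r).trans (Nat.mul_le_mul_right _ hkq)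
    have hupd := hpopular U C φ hφ f g hg'
    obtain ⟨a⟩ := hV
    refine ⟨f, ?_, hupd⟩
    simpa using hupd a (g a ⟨0, hl⟩) (f a) (hg' a _)
  have hsurj : Function.Surjective (Prod.fst : Vert V (k * l) n → V) := fun b =>
    ⟨(b, ⟨0, hT⟩, ⟨0, hn⟩), rfl⟩
  refine ⟨Vert V (k * l) n, inferInstance, E, Prod.fst, ?_, hsurj, hψ,
    le_girth_of_not_reachIn hcl, fun U _ C _ hU => ⟨?_, ?_⟩, fun U _ C _ hU hC φ hφ => ?_⟩
  · rintro y ⟨h, _, hy⟩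
    rcases hy.adj_or_level_lt with h' | h'
    · exact hD _ h'
    · exact lt_irrefl _ h'.2
  · rintro ⟨φ, hφ⟩
    obtain ⟨f, hf, _⟩ := hmajor U C hU φ hφ
    exact ⟨f, hf⟩
  · rintro ⟨f, hf⟩
    exact ⟨f ∘ Prod.fst, hf.comp hψ⟩
  · obtain ⟨f, hf, hupd⟩ := hmajor U C hU φ hφ
    have hcount := mul_card_exceptional_le hU φ f fun b t c hc =>
      eq_of_isPointed hC hf (hupd b t c hc)
    have hX : (univ.filter fun y => φ y ≠ f y.1) = ∅ := by
      by_contra hne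
      obtain ⟨x, hx, j, hj⟩ := hsmall _ (nonempty_iff_ne_empty.mpr hne) (by
        refine Nat.le_of_mul_le_mul_left ?_ (Nat.mul_pos hmpos hk)
        calc m * k * (#{y | φ y ≠ f y.1} * M) = q * #{y | φ y ≠ f y.1} := by rw [hq]; ring
          _ ≤ m * (k * n) := hcount
          _ = m * k * n := by ring)
      refine (mem_filter.mp hx).2 (eq_of_isPointed hC hf
        (hcopyHom U C φ hφ f (x, fun _ => Fin.castLEOrderEmb hlT, j) fun σ _ => ?_))
      by_contra hcon
      exact hj σ (mem_filter.mpr ⟨mem_univ _, hcon⟩)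
    have hφf : φ = f ∘ Prod.fst := by
      funext y
      by_contra hcon
      exact notMem_empty y (hX ▸ mem_filter.mpr ⟨mem_univ y, hcon⟩)
    refine ⟨f, ⟨hf, hφf⟩, fun f' hf' => ?_⟩
    exact hsurj.injective_comp_right (hf'.2.symm.trans hφf)
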